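/- The following is a theorem of Zermelo--Fraenkel set theory ZF, without any form of the Axiom of Choice (equivalently, it holds in every model $(M,\in)$ of ZF, all notions being understood inside the model). Let $X$ be an infinite set such that the set of all finite subsets of $X$ is Dedekind-finite (every injection of it into itself is surjective); such an $X$ is called CF. Suppose that there is no finitely additive probability measure $\mu\colon\mathcal P(X)\to[0,1]$ with $\mu(\{x\})=0$ for all $x\in X$. Let $\ell^2(X)$ be the space of all $\eta\colon X\to\mathbb C$ with $\sum_{x\in X}|\eta(x)|^2<\infty$, and let $\mathcal B(\ell^2(X))$ be the $\mathrm C^*$-algebra of bounded linear operators on $\ell^2(X)$. Then: 1. $\mathcal B(\ell^2(X))$ is stably finite: for every natural number $n$ there is no $v\in M_n(\mathcal B(\ell^2(X)))$ with $v^*v=1$ and $vv^*\neq v^*v$; 2. $\mathcal B(\ell^2(X))$ has no tracial state, i.e. there is no positive linear functional $\tau\colon\mathcal B(\ell^2(X))\to\mathbb C$ with $\tau(1)=1$ and $\tau(ST)=\tau(TS)$ for all $S,T$; 3. the states of $\mathcal B(\ell^2(X))$ separate points: for all $S\neq T$ in $\mathcal B(\ell^2(X))$ there is a positive linear functional $\varphi$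 with $\varphi(1)=1$ and $\varphi(S)\neq\varphi(T)$. -/

import Mathlib

/-! A theorem of ZF (no choice) is a statement that holds in every model of ZF. This file sets up
models `(M, ∈)` of first-order ZF and, inside an arbitrary model, the notions of analysis that are
needed. "Internal" means "in the sense of the model": an internal function is one whose graph is an
element of the model, and quantifiers over sets, functions, sequences, operators and functionals
range over internal ones only. -/

universe u v w

namespace ZFModel

/-- The only symbol of the language of set theory: the binary relation symbol `∈`. -/
inductive SetRel : ℕ → Type
  | mem : SetRel 2

/-- The first-order language of set theory. -/
def setLang : FirstOrder.Language := ⟨fun _ => Empty, SetRel⟩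

/-- A type with a membership relation is a structure for the language of set theory. -/
instance setStructure (M : Type u) [Membership M M] : setLang.Structure M where
  funMap := fun f _ => nomatch f
  RelMap := fun r x => match r, x with
    | SetRel.mem, x => x 0 ∈ x 1

/-- `(M, ∈)` is a model of Zermelo-Fraenkel set theory (without choice). Separation and replacement
are the first-order schemas: `Definable` is first-order definability with parameters from `M`. -/
class ModelsZF (M : Type u) [Membership M M] : Prop where
  extensionality : ∀ a b : M, (∀ x : M, x ∈ a ↔ x ∈ b) → a = b
  foundation : ∀ a : M, (∃ x : M, x ∈ a) → ∃ x : M, x ∈ a ∧ ∀ y : M, y ∈ x → y ∉ a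
  pairing : ∀ a b : M, ∃ c : M, ∀ x : M, x ∈ c ↔ x = a ∨ x = b
  union : ∀ a : M, ∃ c : M, ∀ x : M, x ∈ c ↔ ∃ y : M, y ∈ a ∧ x ∈ y
  powerset : ∀ a : M, ∃ c : M, ∀ x : M, x ∈ c ↔ ∀ y : M, y ∈ x → y ∈ a
  infinity : ∃ c : M, (∃ e : M, e ∈ c ∧ ∀ x : M, x ∉ e) ∧
    ∀ x : M, x ∈ c → ∃ y : M, y ∈ c ∧ ∀ z : M, z ∈ y ↔ z ∈ x ∨ z = x
  separation : ∀ S : Set M, (Set.univ : Set M).Definable₁ setLang S →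
    ∀ a : M, ∃ c : M, ∀ x : M, x ∈ c ↔ x ∈ a ∧ x ∈ S
  replacement : ∀ F : Set (M × M), (Set.univ : Set M).Definable₂ setLang F →
    ∀ a : M, (∀ x : M, x ∈ a → ∃! y : M, (x, y) ∈ F) →
    ∃ c : M, ∀ y : M, y ∈ c ↔ ∃ x : M, x ∈ a ∧ (x, y) ∈ F

section Sets

variable {M : Type u} [Membership M M] [ModelsZF M]

theorem exists_empty (M : Type u) [Membership M M] [ModelsZF M] : ∃ e : M, ∀ x : M, x ∉ e := by
  obtain ⟨_, ⟨e, _, he⟩, _⟩ := ModelsZF.infinity (M := M)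
  exact ⟨e, he⟩

theorem exists_succ (a : M) : ∃ c : M, ∀ x : M, x ∈ c ↔ x ∈ a ∨ x = a := by
  obtain ⟨s, hs⟩ := ModelsZF.pairing a a
  obtain ⟨p, hp⟩ := ModelsZF.pairing a s
  obtain ⟨c, hc⟩ := ModelsZF.union p
  refine ⟨c, fun x => ?_⟩
  rw [hc]
  constructor
  · rintro ⟨y, hy, hx⟩
    rcases (hp y).1 hy with rfl | rfl
    · exact Or.inl hx
    · exact Or.inr (by simpa using (hs x).1 hx)
  · rintro (h | rfl)
    · exact ⟨a, (hp a).2 (Or.inl rfl), h⟩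
    · exact ⟨s, (hp s).2 (Or.inr rfl), (hs x).2 (Or.inl rfl)⟩

/-- The empty set. -/
noncomputable def empty (M : Type u) [Membership M M] [ModelsZF M] : M := (exists_empty M).choose

/-- The von Neumann successor `a ∪ {a}`. -/
noncomputable def succ (a : M) : M := (exists_succ a).choose

/-- The unordered pair `{a, b}`. -/
noncomputable def upair (a b : M) : M := (ModelsZF.pairing a b).choose

/-- The Kuratowski pair `{{a}, {a, b}}`. -/
noncomputable def opair (a b : M) : M := upair (upair a a) (upair a b)

theorem not_mem_empty (x : M) : x ∉ empty M := (exists_empty M).choose_spec x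

theorem mem_succ {a x : M} : x ∈ succ a ↔ x ∈ a ∨ x = a := (exists_succ a).choose_spec x

theorem mem_upair {a b x : M} : x ∈ upair a b ↔ x = a ∨ x = b :=
  (ModelsZF.pairing a b).choose_spec x

theorem upair_inj_right {a b c : M} (h : upair a b = upair a c) : b = c := by
  have hb : b ∈ upair a c := h ▸ mem_upair.2 (Or.inr rfl)
  have hc : c ∈ upair a b := h ▸ mem_upair.2 (Or.inr rfl)
  rcases mem_upair.1 hb with hb | hb
  · rcases mem_upair.1 hc with hc | hc
    · rw [hb, hc]
    · exact hc.symm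
  · exact hb

theorem opair_inj {a b c d : M} (h : opair a b = opair c d) : a = c ∧ b = d := by
  have h1 : a = c := by
    have hc : upair c c ∈ opair a b := h ▸ mem_upair.2 (Or.inl rfl)
    have hm : a ∈ upair c c := by
      rcases mem_upair.1 hc with e | e
      · exact e ▸ mem_upair.2 (Or.inl rfl)
      · exact e ▸ mem_upair.2 (Or.inl rfl)
    simpa using mem_upair.1 hm
  subst h1
  exact ⟨rfl, upair_inj_right (upair_inj_right h)⟩

/-- The elements of the set `a` of the model. -/
abbrev El (a : M) : Type u := {x : M // x ∈ a}

/-- The power set of `a` in the model. -/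
abbrev Pow (a : M) : Type u := {s : M // ∀ x : M, x ∈ s → x ∈ a}

/-- `c` contains the empty set and is closed under successors. -/
def IsInductive (c : M) : Prop := empty M ∈ c ∧ ∀ x : M, x ∈ c → succ x ∈ c

/-- The (von Neumann) natural numbers of the model. If the model is not an ω-model, this type has
nonstandard elements, as it must. A natural number `n` is the set of its predecessors. -/
abbrev Omega (M : Type u) [Membership M M] [ModelsZF M] : Type u :=
  {n : M // ∀ c : M, IsInductive c → n ∈ c}

/-- The natural number zero. -/
noncomputable def Omega.zero (M : Type u) [Membership M M] [ModelsZF M] : Omega M :=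
  ⟨empty M, fun _ hc => hc.1⟩

/-- The successor of a natural number. -/
noncomputable def Omega.succ (n : Omega M) : Omega M :=
  ⟨ZFModel.succ n.1, fun c hc => hc.2 n.1 (n.2 c hc)⟩

end Sets

/-- A type whose elements are coded faithfully by sets of the model. -/
class Coded (M : Type u) [Membership M M] (α : Type v) where
  code : α → M
  code_inj : Function.Injective code

section Coding

variable {M : Type u} [Membership M M] [ModelsZF M]

instance codedSelf : Coded M M := ⟨id, Function.injective_id⟩

instance codedSubtype {α : Type v} [Coded M α] (p : α → Prop) : Coded M (Subtype p) :=
  ⟨fun x => Coded.code x.1, fun _ _ h => Subtype.ext (Coded.code_inj h)⟩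

noncomputable instance codedProd {α : Type v} {β : Type w} [Coded M α] [Coded M β] :
    Coded M (α × β) :=
  ⟨fun x => opair (Coded.code x.1) (Coded.code x.2), fun _ _ h =>
    Prod.ext (Coded.code_inj (opair_inj h).1) (Coded.code_inj (opair_inj h).2)⟩

variable (M) in
/-- The internal functions from `α` to `β`: those whose graph is a set of the model. -/
structure IFun (α : Type v) (β : Type w) [Coded M α] [Coded M β] where
  toFun : α → β
  graph : M
  mem_graph : ∀ z : M, z ∈ graph ↔
    ∃ x : α, z = opair (Coded.code x) (Coded.code (toFun x))

theorem IFun.toFun_injective {α : Type v} {β : Type w} [Coded M α] [Coded M β] :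
    Function.Injective (IFun.toFun : IFun M α β → α → β) := by
  rintro ⟨f, g, hg⟩ ⟨f', g', hg'⟩ (h : f = f')
  subst h
  have : g = g' := ModelsZF.extensionality _ _ fun z => by rw [hg, hg']
  subst this
  rfl

instance {α : Type v} {β : Type w} [Coded M α] [Coded M β] : FunLike (IFun M α β) α β :=
  ⟨IFun.toFun, IFun.toFun_injective⟩

/-- An internal function is coded by its graph. -/
instance codedIFun {α : Type v} {β : Type w} [Coded M α] [Coded M β] : Coded M (IFun M α β) :=
  ⟨IFun.graph, fun f g h => IFun.toFun_injective <| funext fun x => by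
    have hx : opair (Coded.code x) (Coded.code (f.toFun x)) ∈ g.graph :=
      h ▸ (f.mem_graph _).2 ⟨x, rfl⟩
    obtain ⟨y, hy⟩ := (g.mem_graph _).1 hx
    obtain ⟨h1, h2⟩ := opair_inj hy
    rw [Coded.code_inj h1] at *
    exact Coded.code_inj h2⟩

/-- The set `a` is finite in the model: equipotent with a natural number. -/
def IsFin (a : M) : Prop := ∃ (n : Omega M) (e : IFun M (El n.1) (El a)), Function.Bijective e

/-- The finite subsets of `a`, in the model. -/
abbrev FinPow (a : M) : Type u := {s : Pow a // IsFin s.1}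

/-- Dedekind-finiteness in the model. -/
def DedekindFinite (M : Type u) [Membership M M] [ModelsZF M] (α : Type v) [Coded M α] : Prop :=
  ∀ f : IFun M α α, Function.Injective f → Function.Surjective f

/-- `X` is CF in the model: infinite, and the set of its finite subsets is Dedekind-finite. -/
def IsCF (X : M) : Prop := ¬ IsFin X ∧ DedekindFinite M (FinPow X)

/-- `s = ∑ x ∈ F, f x` for a finite set `F` of the model: along an internal enumeration `e` of `F`,
there is an internal sequence `g` of partial sums that ends in `s`. -/
def HasFinSum {A : Type v} [AddCommMonoid A] [Coded M A] (F : M) (f : El F → A) (s : A) : Prop :=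
  ∃ (n : Omega M) (e : IFun M (El n.1) (El F)) (g : IFun M (Omega M) A), Function.Bijective e ∧
    g (Omega.zero M) = 0 ∧
    (∀ (i : Omega M) (hi : i.1 ∈ n.1), g i.succ = g i + f (e ⟨i.1, hi⟩)) ∧ g n = s

/-- `s = ∑ x ∈ F, f x` for a finite subset `F` of `X` and a function `f` on `X`. -/
def HasSumOver {A : Type v} [AddCommMonoid A] [Coded M A] {X : M} (F : FinPow X) (f : El X → A)
    (s : A) : Prop :=
  HasFinSum F.1.1 (fun x => f ⟨x.1, F.1.2 x.1 x.2⟩) s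

end Coding

/-- The field `El R` is the field of real numbers of the model: its operations and order belong to
the model and, in the model, it is a complete ordered field. -/
structure IsReals {M : Type u} [Membership M M] [ModelsZF M] (R : M) [Field (El R)]
    [LinearOrder (El R)] : Prop where
  strictOrdered : IsStrictOrderedRing (El R)
  add_internal : ∃ f : IFun M (El R × El R) (El R), ∀ x y : El R, f (x, y) = x + y
  mul_internal : ∃ f : IFun M (El R × El R) (El R), ∀ x y : El R, f (x, y) = x * y
  le_internal : ∃ l : M, ∀ x y : El R, opair x.1 y.1 ∈ l ↔ x ≤ y
  complete : ∀ s : Pow R, {x : El R | x.1 ∈ s.1}.Nonempty → BddAbove {x : El R | x.1 ∈ s.1} →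
    ∃ c : El R, IsLUB {x : El R | x.1 ∈ s.1} c

section Analysis

variable {M : Type u} [Membership M M] [ModelsZF M] (R : M) [Field (El R)] [LinearOrder (El R)]

/-- The complex numbers `x + i y` over the reals `R` of the model, with `i² = -1`. -/
abbrev Cplx : Type u := QuadraticAlgebra (El R) (-1) 0

/-- A complex number is coded by the pair of its real and imaginary parts. -/
noncomputable instance codedCplx : Coded M (Cplx R) :=
  ⟨fun z => opair z.re.1 z.im.1, fun _ _ h =>
    QuadraticAlgebra.ext (Subtype.ext (opair_inj h).1) (Subtype.ext (opair_inj h).2)⟩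

variable {R}

/-- `|z|²`. -/
def normSq (z : Cplx R) : El R := z.re ^ 2 + z.im ^ 2

/-- `c` is the limit of the sums of `f` over the finite subsets of `X`, directed by inclusion. -/
def HasSumC {X : M} (f : El X → Cplx R) (c : Cplx R) : Prop :=
  ∀ ε : El R, 0 < ε → ∃ F₀ : FinPow X, ∀ F : FinPow X, (∀ x : M, x ∈ F₀.1.1 → x ∈ F.1.1) →
    ∃ s : Cplx R, HasSumOver F f s ∧ normSq (s - c) < ε ^ 2

/-- `∑ x, |η x|² ≤ r`, the sum being the supremum of the sums over finite subsets of `X`. -/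
def NormSqLE {X : M} (η : El X → Cplx R) (r : El R) : Prop :=
  ∀ F : FinPow X, ∃ s : El R, HasSumOver F (fun x => normSq (η x)) s ∧ s ≤ r

variable (R)

/-- The space `ℓ²(X)` of the model. -/
abbrev L2 (X : M) : Type u := {η : IFun M (El X) (Cplx R) // ∃ r : El R, NormSqLE η r}

variable {R} {X : M}

/-- `⟨ξ, η⟩ = c`, where `⟨ξ, η⟩ = ∑ x, ξ x * conj (η x)`. -/
def IsInner (ξ η : L2 R X) (c : Cplx R) : Prop := HasSumC (fun x => ξ.1 x * star (η.1 x)) c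

/-- `T` is linear: if `ζ = a ξ + b η` pointwise, then `T ζ = a T ξ + b T η` pointwise. -/
def IsLinearOp (T : IFun M (L2 R X) (L2 R X)) : Prop :=
  ∀ (a b : Cplx R) (ξ η ζ : L2 R X), (∀ x, ζ.1 x = a * ξ.1 x + b * η.1 x) →
    ∀ x, (T ζ).1 x = a * (T ξ).1 x + b * (T η).1 x

/-- `T` is bounded: `‖T ξ‖² ≤ K ‖ξ‖²` for a constant `K`. -/
def IsBoundedOp (T : IFun M (L2 R X) (L2 R X)) : Prop :=
  ∃ K : El R, ∀ (ξ : L2 R X) (r : El R), NormSqLE ξ.1 r → NormSqLE (T ξ).1 (K * r)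

variable (R X)

/-- The bounded linear operators on `ℓ²(X)`, in the model. -/
abbrev Op : Type u := {T : IFun M (L2 R X) (L2 R X) // IsLinearOp T ∧ IsBoundedOp T}

variable {R X}

/-- `U = a S + b T`. -/
def IsLinComb (a : Cplx R) (S : Op R X) (b : Cplx R) (T U : Op R X) : Prop :=
  ∀ ξ x, (U.1 ξ).1 x = a * (S.1 ξ).1 x + b * (T.1 ξ).1 x

/-- `U = S T`. -/
def IsProd (S T U : Op R X) : Prop := ∀ ξ, U.1 ξ = S.1 (T.1 ξ)

/-- `U = 1`. -/
def IsOne (U : Op R X) : Prop := ∀ ξ, U.1 ξ = ξ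

/-- `U = 0`. -/
def IsZero (U : Op R X) : Prop := ∀ ξ x, (U.1 ξ).1 x = 0

/-- `U = T*`, i.e. `⟨T ξ, η⟩ = ⟨ξ, U η⟩` for all `ξ` and `η`. -/
def IsAdjoint (T U : Op R X) : Prop :=
  ∀ (ξ η : L2 R X) (c : Cplx R), IsInner (T.1 ξ) η c ↔ IsInner ξ (U.1 η) c

variable (R X)

/-- The `n × n` matrices over `𝓑(ℓ²(X))`, for a natural number `n` of the model. -/
abbrev MatOp (n : Omega M) : Type u := IFun M (El n.1 × El n.1) (Op R X)

variable {R X} {n : Omega M}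

/-- The matrix product `c = a b`: `c i j = ∑ k, a i k * b k j`, the sum of operators being
pointwise. -/
def IsMatProd (a b c : MatOp R X n) : Prop :=
  ∀ (i j : El n.1) (ξ : L2 R X) (x : El X),
    HasFinSum n.1 (fun k => ((a (i, k)).1 ((b (k, j)).1 ξ)).1 x) (((c (i, j)).1 ξ).1 x)

/-- `c` is the identity matrix. -/
def IsMatOne (c : MatOp R X n) : Prop :=
  ∀ i j : El n.1, (i = j → IsOne (c (i, j))) ∧ (i ≠ j → IsZero (c (i, j)))

/-- `b` is the adjoint matrix of `a`. -/
def IsMatAdjoint (a b : MatOp R X n) : Prop := ∀ i j : El n.1, IsAdjoint (a (i, j)) (b (j, i))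

variable (R X)

/-- `M_n(𝓑(ℓ²(X)))` is finite: there is no `v` with `v* v = 1` and `v v* ≠ v* v`. -/
def IsFiniteMatAlg (n : Omega M) : Prop :=
  ¬ ∃ v w p q : MatOp R X n, IsMatAdjoint v w ∧ IsMatProd w v p ∧ IsMatProd v w q ∧
    IsMatOne p ∧ q ≠ p

/-- `𝓑(ℓ²(X))` is stably finite in the model. -/
def IsStablyFinite : Prop := ∀ n : Omega M, IsFiniteMatAlg R X n

variable {R X}

/-- `φ` is a state of `𝓑(ℓ²(X))`: linear, positive (`φ (T* T) ≥ 0`) and `φ 1 = 1`. -/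
structure IsState (φ : IFun M (Op R X) (Cplx R)) : Prop where
  linear : ∀ (a b : Cplx R) (S T U : Op R X), IsLinComb a S b T U → φ U = a * φ S + b * φ T
  positive : ∀ T S P : Op R X, IsAdjoint T S → IsProd S T P → 0 ≤ (φ P).re ∧ (φ P).im = 0
  unital : ∃ I : Op R X, IsOne I ∧ φ I = 1

/-- `φ` is a tracial state: a state with `φ (S T) = φ (T S)`. -/
def IsTracialState (φ : IFun M (Op R X) (Cplx R)) : Prop :=
  IsState φ ∧ ∀ S T P Q : Op R X, IsProd S T P → IsProd T S Q → φ P = φ Q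

/-- `μ` is a finitely additive probability measure on the power set of `X`, in the model. -/
structure IsFinAddProb (μ : IFun M (Pow X) (El R)) : Prop where
  nonneg : ∀ A, 0 ≤ μ A
  additive : ∀ A B C : Pow X, (∀ x : M, x ∈ A.1 → x ∉ B.1) →
    (∀ x : M, x ∈ C.1 ↔ x ∈ A.1 ∨ x ∈ B.1) → μ C = μ A + μ B
  total : ∀ A : Pow X, A.1 = X → μ A = 1

/-- `μ` vanishes on singletons. -/
def VanishesOnSingletons (μ : IFun M (Pow X) (El R)) : Prop :=
  ∀ (A : Pow X) (a : M), (∀ x : M, x ∈ A.1 ↔ x = a) → μ A = 0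

end Analysis

end ZFModel

/-! Dedekind-finiteness of the set of finite subsets of `X` means that chains of finite subsets
stop. In a nonempty chain without largest element every member has a next one, and the map that
sends each member to the next and fixes all other finite sets is injective but misses the smallest
member (`FinPow.exists_greatest_of_chain`). Two consequences carry the theorem.

A square-summable `ξ` has finite support (`L2.exists_support`): the level sets `{|ξ|² ≥ ε}` are
finite because the sums are bounded, they form a chain, and the largest of them is the whole
support. Hence `ℓ²(X)` consists of finitely supported functions, inner products are finite sums, and
an operator is determined by its matrix in the basis `e_y`.

A finite subset of `X` generates a finite subset under a locally finite relation
(`FinPow.exists_closed_rel`). Applied to the supports of `v_ij e_y` and of the entries of `v*` at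
`e_y`, this gives finite sets `K`, containing any prescribed points, that are invariant under all
entries of `v` and `v*`. If `v* v = 1`, then `v` restricts to an isometric matrix indexed by `n ×
K`, which is unitary, so `v v* = 1`. As `n` and `K` may have nonstandard size, this last fact is
proved inside the model by a trace computation (`dsum_mul_star_of_isometry`): `Q = V V*` is a
projection with the trace of `1`, so the sum of all `|Q - 1|²` is the trace of `1 - Q`, which is
`0`.

A tracial state `τ` induces the measure `A ↦ Re τ(P_A)`, with `P_A` the projection onto functions
supported on `A`. Matrix units show that all singletons have the same mass, and this mass is `0`
because `X` is infinite and the total mass is `1`. Separation by states follows from vector states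
and polarization.

Each construction has to produce an element of the model. `DefPred` and `Internal` turn this into a
syntactic check by `fun_prop`, and induction is available for internal predicates only. A `choose`
made outside the model is harmless when the chosen object is uniquely determined by an internal
relation. -/

set_option linter.unusedSectionVars false

namespace ZFModel

/-! ### First-order definability in a model -/

section Definability

/-- A type of tuples of elements of `M`. -/
class Tuple (M : Type u) (Γ : Type u) where
  ι : Type
  fin : Finite ι
  equiv : Γ ≃ (ι → M)

attribute [instance] Tuple.fin

instance tupleSelf (M : Type u) : Tuple M M where
  ι := Unit
  fin := inferInstance
  equiv := (Equiv.funUnique Unit M).symm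

instance tupleProd (M : Type u) (Γ Δ : Type u) [Tuple M Γ] [Tuple M Δ] : Tuple M (Γ × Δ) where
  ι := Tuple.ι M Γ ⊕ Tuple.ι M Δ
  fin := inferInstance
  equiv := (Equiv.prodCongr Tuple.equiv Tuple.equiv).trans (Equiv.sumArrowEquivProdArrow _ _ _).symm

variable (M : Type u) [Membership M M] {Γ Δ Θ : Type u} [Tuple M Γ] [Tuple M Δ] [Tuple M Θ]

/-- Maps between tuples that are first-order definable with parameters. -/
@[fun_prop]
def DefMap (f : Γ → Δ) : Prop :=
  (Set.univ : Set M).DefinableMap setLang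
    (fun v : Tuple.ι M Γ → M => Tuple.equiv (f (Tuple.equiv.symm v)))

/-- Relations between tuples that are first-order definable with parameters. -/
@[fun_prop]
def DefPred (P : Γ → Prop) : Prop :=
  (Set.univ : Set M).Definable setLang {v : Tuple.ι M Γ → M | P (Tuple.equiv.symm v)}

variable {M}

@[fun_prop]
theorem defMap_id : DefMap M (id : Γ → Γ) := fun _ => by
  simpa using! Set.DefinableFun.proj setLang

@[fun_prop]
theorem defMap_const (c : Δ) : DefMap M (fun _ : Γ => c) := fun _ =>
  FirstOrder.Language.definableFun_const setLang _ (Set.mem_univ _)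

@[fun_prop]
theorem DefMap.comp {g : Δ → Θ} {f : Γ → Δ} (hg : DefMap M g) (hf : DefMap M f) :
    DefMap M (fun x => g (f x)) := fun i => by
  simpa using! Set.DefinableFun.comp hf (hg i)

@[fun_prop]
theorem DefMap.fst {f : Γ → Δ × Θ} (hf : DefMap M f) : DefMap M (fun x => (f x).1) := fun i =>
  hf (Sum.inl i)

@[fun_prop]
theorem DefMap.snd {f : Γ → Δ × Θ} (hf : DefMap M f) : DefMap M (fun x => (f x).2) := fun i =>
  hf (Sum.inr i)

@[fun_prop]
theorem DefMap.prodMk {f : Γ → Δ} {g : Γ → Θ} (hf : DefMap M f) (hg : DefMap M g) :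
    DefMap M (fun x => (f x, g x)) := fun i =>
  match i with
  | Sum.inl i => hf i
  | Sum.inr i => hg i

@[fun_prop]
theorem DefPred.comp {P : Δ → Prop} {f : Γ → Δ} (hP : DefPred M P) (hf : DefMap M f) :
    DefPred M (fun x => P (f x)) := by
  simpa [DefPred] using! Set.Definable.preimage_map hf hP

theorem defPred_mem_rel : DefPred M (fun p : M × M => p.1 ∈ p.2) := by
  refine Set.Definable.mono (Set.empty_definable_iff.2 ⟨FirstOrder.Language.Relations.formula₂
    (L := setLang) SetRel.mem (FirstOrder.Language.Term.var (Sum.inl ()))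
    (FirstOrder.Language.Term.var (Sum.inr ())), ?_⟩) (Set.empty_subset _)
  ext v
  exact Iff.rfl

@[fun_prop]
theorem DefMap.mem {f g : Γ → M} (hf : DefMap M f) (hg : DefMap M g) :
    DefPred M (fun x => f x ∈ g x) := DefPred.comp defPred_mem_rel (hf.prodMk hg)

@[fun_prop]
theorem DefMap.eq {f g : Γ → M} (hf : DefMap M f) (hg : DefMap M g) :
    DefPred M (fun x => f x = g x) := (hf ()).ofPred_eq (hg ())

@[fun_prop]
theorem DefPred.and {P Q : Γ → Prop} (hP : DefPred M P) (hQ : DefPred M Q) :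
    DefPred M (fun x => P x ∧ Q x) := Set.Definable.inter hP hQ

@[fun_prop]
theorem DefPred.or {P Q : Γ → Prop} (hP : DefPred M P) (hQ : DefPred M Q) :
    DefPred M (fun x => P x ∨ Q x) := Set.Definable.union hP hQ

@[fun_prop]
theorem DefPred.not {P : Γ → Prop} (hP : DefPred M P) :
    DefPred M (fun x => ¬ P x) := Set.Definable.compl hP

@[fun_prop]
theorem DefPred.iff {P Q : Γ → Prop} (hP : DefPred M P) (hQ : DefPred M Q) :
    DefPred M (fun x => P x ↔ Q x) := by
  simp only [iff_iff_and_or_not_and_not]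
  fun_prop

@[fun_prop]
theorem DefPred.exists {P : Γ → M → Prop} (hP : DefPred M (fun p : Γ × M => P p.1 p.2)) :
    DefPred M (fun x => ∃ y, P x y) := by
  have h := Set.Definable.exists_of_finite hP
  rw [DefPred]
  convert h using 1
  ext v
  constructor
  · rintro ⟨y, hy⟩
    exact ⟨fun _ => y, hy⟩
  · rintro ⟨y, hy⟩
    exact ⟨y (), hy⟩

/-- The rules for `fun_prop` cover `∧`, `∨`, `¬`, `↔` and `∃`. Universal quantifiers are rewritten
with this lemma, and implications with `imp_iff_not_or`. -/
theorem forall_iff_not_exists_not {α : Type*} {p : α → Prop} : (∀ x, p x) ↔ ¬ ∃ x, ¬ p x :=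
  not_exists_not.symm

theorem DefMap.of_graph {f : Γ → M} (hf : DefPred M (fun p : Γ × M => p.2 = f p.1)) :
    DefMap M f := fun i => by
  -- `Function.tupleGraph` indexes the value by `none`, whereas the coordinates of `Γ × M` are
  -- indexed by a sum; the graph is reindexed accordingly.
  have h := Set.Definable.preimage_comp
    (fun j : Tuple.ι M (Γ × M) => match j with
      | Sum.inl j => some j
      | Sum.inr _ => none) hf
  have he : ∀ w : Option (Tuple.ι M Γ) → M, Tuple.equiv.symm (w ∘ some) =
      (Tuple.equiv.symm fun j => w (some j) : Γ) := fun w => rfl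
  rw [Set.DefinableFun]
  convert h using 1
  ext w
  simp only [Function.tupleGraph]
  exact eq_comm

variable [ModelsZF M]

theorem exists_separation {P : M → Prop} (hP : DefPred M P) (a : M) :
    ∃ c : M, ∀ x : M, x ∈ c ↔ x ∈ a ∧ P x :=
  ModelsZF.separation {x | P x}
    (Set.Definable.preimage_comp (fun _ : Tuple.ι M M => (0 : Fin 1)) hP) a

theorem exists_replacement {P : M × M → Prop} (hP : DefPred M P) (a : M)
    (ha : ∀ x : M, x ∈ a → ∃! y : M, P (x, y)) :
    ∃ c : M, ∀ y : M, y ∈ c ↔ ∃ x : M, x ∈ a ∧ P (x, y) :=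
  ModelsZF.replacement {x | P x}
    (Set.Definable.preimage_comp (Sum.elim (fun _ => (0 : Fin 2)) (fun _ => 1) :
      Tuple.ι M (M × M) → Fin 2) hP) a ha

theorem eq_upair_iff {a b c : M} : c = upair a b ↔ ∀ x, x ∈ c ↔ x = a ∨ x = b :=
  ⟨fun h _ => h ▸ mem_upair, fun h => ModelsZF.extensionality _ _ fun x => (h x).trans
    mem_upair.symm⟩

@[fun_prop]
theorem DefMap.upair {f g : Γ → M} (hf : DefMap M f) (hg : DefMap M g) :
    DefMap M (fun x => upair (f x) (g x)) := by
  apply DefMap.of_graph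
  simp only [eq_upair_iff, forall_iff_not_exists_not]
  fun_prop

@[fun_prop]
theorem DefMap.opair {f g : Γ → M} (hf : DefMap M f) (hg : DefMap M g) :
    DefMap M (fun x => opair (f x) (g x)) := by
  unfold ZFModel.opair
  fun_prop

theorem eq_succ_iff {a c : M} : c = succ a ↔ ∀ x, x ∈ c ↔ x ∈ a ∨ x = a :=
  ⟨fun h _ => h ▸ mem_succ, fun h => ModelsZF.extensionality _ _ fun x => (h x).trans
    mem_succ.symm⟩

@[fun_prop]
theorem DefMap.succ {f : Γ → M} (hf : DefMap M f) : DefMap M (fun x => succ (f x)) := by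
  apply DefMap.of_graph
  simp only [eq_succ_iff, forall_iff_not_exists_not]
  fun_prop

end Definability

/-! ### Internal functions and predicates -/

section Internal

open Coded

variable (M : Type u) [Membership M M] [ModelsZF M]

/-- The codes of the elements of `α` form a set of the model. -/
class IsSet (α : Type v) [Coded M α] : Prop where
  exists_range : ∃ c : M, ∀ z : M, z ∈ c ↔ ∃ x : α, z = code x

/-- The set of codes of the elements of `α`. -/
noncomputable def range (α : Type v) [Coded M α] [IsSet M α] : M :=
  (IsSet.exists_range (M := M) (α := α)).choose

open Classical in
/-- The truth values are coded by the ordinals `0` and `1`. -/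
noncomputable instance codedProp : Coded M Prop :=
  ⟨fun p => if p then succ (empty M) else empty M, fun p q h => by
    have h0 : succ (empty M) ≠ empty M := fun h =>
      not_mem_empty (empty M) (by
        have := mem_succ.2 (Or.inr rfl : empty M ∈ empty M ∨ _)
        rwa [h] at this)
    by_cases hp : p <;> by_cases hq : q <;> simp_all [h0.symm]⟩

variable {α : Type v} {β : Type w} {γ : Type*} {δ : Type*}
  [Coded M α] [Coded M β] [Coded M γ] [Coded M δ]

/-- `f` is an internal function. Predicates are functions to the type of truth values. -/
@[fun_prop]
def Internal (f : α → β) : Prop := ∃ g : IFun M α β, ⇑g = f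

variable {M}

theorem mem_range [IsSet M α] {z : M} : z ∈ range M α ↔ ∃ x : α, z = code x :=
  (IsSet.exists_range (M := M) (α := α)).choose_spec z

theorem code_mem_range [IsSet M α] (x : α) : code x ∈ range M α := mem_range.2 ⟨x, rfl⟩

theorem codedSelf_code (a : M) : @code M _ M codedSelf a = a := rfl

theorem codedProd_code (x : α × β) : (code x : M) = opair (code x.1) (code x.2) := rfl

theorem codedIFun_code (f : IFun M α β) : (code f : M) = f.graph := rfl

theorem IFun.opair_mem_graph (f : IFun M α β) (x : α) (b : M) :
    opair (code x) b ∈ f.graph ↔ b = code (f x) := by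
  rw [f.mem_graph]
  constructor
  · rintro ⟨y, hy⟩
    obtain ⟨h1, h2⟩ := opair_inj hy
    rw [Coded.code_inj h1]
    exact h2
  · rintro rfl
    exact ⟨x, rfl⟩

@[ext]
theorem IFun.ext {f g : IFun M α β} (h : ∀ x, f x = g x) : f = g :=
  DFunLike.coe_injective (funext h)

/-- As the codes of `α` form a set, replacement collects the pairs of the graph. This is the bridge
by which closure properties of definable relations pass to internal functions; `Q` may be arbitrary
away from the codes. -/
theorem internal_iff_def [IsSet M α] {f : α → β} : Internal M f ↔
    ∃ Q : M × M → Prop, DefPred M Q ∧ ∀ x b, Q (code x, b) ↔ b = code (f x) := by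
  constructor
  · rintro ⟨g, rfl⟩
    exact ⟨fun p => opair p.1 p.2 ∈ g.graph, by fun_prop, g.opair_mem_graph⟩
  · rintro ⟨Q, hQ, hf⟩
    have hP : DefPred M (fun p : M × M => ∃ b, Q (p.1, b) ∧ p.2 = opair p.1 b) := by fun_prop
    obtain ⟨c, hc⟩ := exists_replacement hP (range M α) (by
      intro a ha
      obtain ⟨x, rfl⟩ := mem_range.1 ha
      exact ⟨opair (code x) (code (f x)), ⟨_, (hf _ _).2 rfl, rfl⟩, by
        rintro z ⟨b, hb, hz⟩
        rw [← (hf _ _).1 hb]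
        exact hz⟩)
    refine ⟨⟨f, c, fun z => ?_⟩, rfl⟩
    rw [hc]
    constructor
    · rintro ⟨a, ha, b, hb, h⟩
      obtain ⟨x, rfl⟩ := mem_range.1 ha
      exact ⟨x, by rw [← (hf _ _).1 hb]; exact h⟩
    · rintro ⟨x, rfl⟩
      exact ⟨code x, code_mem_range x, code (f x), (hf _ _).2 rfl, rfl⟩

theorem code_true {p : Prop} (hp : p) : (code p : M) = succ (empty M) := if_pos hp

theorem code_false {p : Prop} (hp : ¬ p) : (code p : M) = empty M := if_neg hp

theorem code_eq_succ_empty {p : Prop} : succ (empty M) = (code p : M) ↔ p := by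
  rw [← code_true (M := M) trivial, Coded.code_inj.eq_iff]
  simp

theorem internal_iff_defPred [IsSet M α] {P : α → Prop} : Internal M P ↔
    ∃ Q : M → Prop, DefPred M Q ∧ ∀ x, Q (code x) ↔ P x := by
  rw [internal_iff_def]
  constructor
  · rintro ⟨Q, hQ, h⟩
    refine ⟨fun a => Q (a, succ (empty M)), by fun_prop, fun x => ?_⟩
    simp only [h, code_eq_succ_empty]
  · rintro ⟨Q, hQ, h⟩
    refine ⟨fun p => (Q p.1 ∧ p.2 = succ (empty M)) ∨ (¬ Q p.1 ∧ p.2 = empty M), by fun_prop,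
      fun x b => ?_⟩
    by_cases hx : P x
    · simp [h, hx, code_true]
    · simp [h, hx, code_false]

/-- An internal function, bundled. -/
noncomputable def Internal.toIFun {f : α → β} (hf : Internal M f) : IFun M α β := hf.choose

@[simp]
theorem Internal.toIFun_apply {f : α → β} (hf : Internal M f) (x : α) : hf.toIFun x = f x :=
  congrFun hf.choose_spec x

theorem IFun.internal (f : IFun M α β) : Internal M f := ⟨f, rfl⟩

variable [IsSet M α]

theorem internal_of_def {f : α → β} (Q : M × M → Prop) (hQ : DefPred M Q)
    (h : ∀ x b, Q (code x, b) ↔ b = code (f x)) : Internal M f := internal_iff_def.2 ⟨Q, hQ, h⟩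

theorem internal_of_defPred {P : α → Prop} (Q : M → Prop) (hQ : DefPred M Q)
    (h : ∀ x, Q (code x) ↔ P x) : Internal M P := internal_iff_defPred.2 ⟨Q, hQ, h⟩

@[fun_prop]
theorem internal_id : Internal M (id : α → α) :=
  internal_of_def (fun p => p.2 = p.1) (by fun_prop) fun _ _ => Iff.rfl

@[fun_prop]
theorem internal_const (c : β) : Internal M (fun _ : α => c) :=
  internal_of_def (fun p => p.2 = code c) (by fun_prop) fun _ _ => Iff.rfl

@[fun_prop]
theorem Internal.comp [IsSet M β] {g : β → γ} {f : α → β} (hg : Internal M g)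
    (hf : Internal M f) : Internal M (fun x => g (f x)) := by
  obtain ⟨G, hG, hg⟩ := internal_iff_def.1 hg
  obtain ⟨F, hF, hf⟩ := internal_iff_def.1 hf
  exact internal_of_def (fun p => ∃ b, F (p.1, b) ∧ G (b, p.2)) (by fun_prop) fun x c => by
    simp [hf, hg]

@[fun_prop]
theorem Internal.prodMk {f : α → β} {g : α → γ} (hf : Internal M f) (hg : Internal M g) :
    Internal M (fun x => (f x, g x)) := by
  obtain ⟨F, hF, hf⟩ := internal_iff_def.1 hf
  obtain ⟨G, hG, hg⟩ := internal_iff_def.1 hg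
  exact internal_of_def (fun p => ∃ b c, F (p.1, b) ∧ G (p.1, c) ∧ p.2 = opair b c)
    (by fun_prop) fun x c => by simp [hf, hg, codedProd_code]

@[fun_prop]
theorem Internal.fst {f : α → β × γ} (hf : Internal M f) : Internal M (fun x => (f x).1) := by
  obtain ⟨F, hF, hf⟩ := internal_iff_def.1 hf
  refine internal_of_def (fun p => ∃ c, F (p.1, opair p.2 c)) (by fun_prop) fun x c => ?_
  simp only [hf, codedProd_code]
  exact ⟨fun ⟨_, h⟩ => (opair_inj h).1, fun h => ⟨_, by rw [h]⟩⟩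

@[fun_prop]
theorem Internal.snd {f : α → β × γ} (hf : Internal M f) : Internal M (fun x => (f x).2) := by
  obtain ⟨F, hF, hf⟩ := internal_iff_def.1 hf
  refine internal_of_def (fun p => ∃ c, F (p.1, opair c p.2)) (by fun_prop) fun x c => ?_
  simp only [hf, codedProd_code]
  exact ⟨fun ⟨_, h⟩ => (opair_inj h).2, fun h => ⟨_, by rw [h]⟩⟩

@[fun_prop]
theorem Internal.val {p : β → Prop} {f : α → Subtype p} (hf : Internal M f) :
    Internal M (fun x => (f x).1) := by
  obtain ⟨F, hF, hf⟩ := internal_iff_def.1 hf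
  exact internal_of_def F hF hf

@[fun_prop]
theorem Internal.subtypeMk {p : β → Prop} {f : α → β} (hf : Internal M f) (h : ∀ x, p (f x)) :
    Internal M (fun x => (⟨f x, h x⟩ : Subtype p)) := by
  obtain ⟨F, hF, hf⟩ := internal_iff_def.1 hf
  exact internal_of_def F hF hf

theorem Internal.of_val {p : β → Prop} {f : α → Subtype p} (hf : Internal M (fun x => (f x).1)) :
    Internal M f := hf.subtypeMk fun x => (f x).2

@[fun_prop]
theorem Internal.mem {f g : α → M} (hf : Internal M f) (hg : Internal M g) :
    Internal M (fun x => f x ∈ g x) := by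
  obtain ⟨F, hF, hf⟩ := internal_iff_def.1 hf
  obtain ⟨G, hG, hg⟩ := internal_iff_def.1 hg
  exact internal_of_defPred (fun a => ∃ b c, F (a, b) ∧ G (a, c) ∧ b ∈ c) (by fun_prop)
    fun x => by simp [hf, hg, codedSelf_code]

@[fun_prop]
theorem Internal.eq {f g : α → β} (hf : Internal M f) (hg : Internal M g) :
    Internal M (fun x => f x = g x) := by
  obtain ⟨F, hF, hf⟩ := internal_iff_def.1 hf
  obtain ⟨G, hG, hg⟩ := internal_iff_def.1 hg
  exact internal_of_defPred (fun a => ∃ b, F (a, b) ∧ G (a, b)) (by fun_prop)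
    fun x => by simp [hf, hg, Coded.code_inj.eq_iff]

@[fun_prop]
theorem Internal.and {P Q : α → Prop} (hP : Internal M P) (hQ : Internal M Q) :
    Internal M (fun x => P x ∧ Q x) := by
  obtain ⟨F, hF, hP⟩ := internal_iff_defPred.1 hP
  obtain ⟨G, hG, hQ⟩ := internal_iff_defPred.1 hQ
  exact internal_of_defPred (fun a => F a ∧ G a) (by fun_prop) fun x => by simp [hP, hQ]

@[fun_prop]
theorem Internal.or {P Q : α → Prop} (hP : Internal M P) (hQ : Internal M Q) :
    Internal M (fun x => P x ∨ Q x) := by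
  obtain ⟨F, hF, hP⟩ := internal_iff_defPred.1 hP
  obtain ⟨G, hG, hQ⟩ := internal_iff_defPred.1 hQ
  exact internal_of_defPred (fun a => F a ∨ G a) (by fun_prop) fun x => by simp [hP, hQ]

@[fun_prop]
theorem Internal.not {P : α → Prop} (hP : Internal M P) : Internal M (fun x => ¬ P x) := by
  obtain ⟨F, hF, hP⟩ := internal_iff_defPred.1 hP
  exact internal_of_defPred (fun a => ¬ F a) (by fun_prop) fun x => by simp [hP]

@[fun_prop]
theorem Internal.iff {P Q : α → Prop} (hP : Internal M P) (hQ : Internal M Q) :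
    Internal M (fun x => P x ↔ Q x) := by
  simp only [iff_iff_and_or_not_and_not]
  fun_prop

theorem Internal.imp {P Q : α → Prop} (hP : Internal M P) (hQ : Internal M Q) :
    Internal M (fun x => P x → Q x) := by
  simp only [imp_iff_not_or]
  fun_prop

/-- Replacement forms each slice `{a} × β`, replacement again forms the set of all slices, and the
product is its union. -/
instance isSetProd [IsSet M β] : IsSet M (α × β) := by
  have hP : ∀ a : M, DefPred M (fun p : M × M => p.2 = opair a p.1) := fun a => by fun_prop
  have hQ : DefPred M (fun p : M × M => ∀ z, z ∈ p.2 ↔ ∃ b, b ∈ range M β ∧ z = opair p.1 b) := by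
    simp only [forall_iff_not_exists_not]
    fun_prop
  obtain ⟨c, hc⟩ := exists_replacement hQ (range M α) (by
    intro a _
    obtain ⟨s, hs⟩ := exists_replacement (hP a) (range M β) fun b _ =>
      ⟨opair _ b, rfl, fun _ h => h⟩
    exact ⟨s, hs, fun t ht => ModelsZF.extensionality _ _ fun z => (ht z).trans (hs z).symm⟩)
  obtain ⟨d, hd⟩ := ModelsZF.union c
  refine ⟨d, fun z => ?_⟩
  rw [hd]
  constructor
  · rintro ⟨s, hs, hz⟩
    obtain ⟨a, ha, h⟩ := (hc s).1 hs
    obtain ⟨b, hb, rfl⟩ := (h z).1 hz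
    obtain ⟨x, rfl⟩ := mem_range.1 ha
    obtain ⟨y, rfl⟩ := mem_range.1 hb
    exact ⟨(x, y), rfl⟩
  · rintro ⟨⟨x, y⟩, rfl⟩
    obtain ⟨s, hs⟩ := exists_replacement (hP (Coded.code x)) (range M β)
      fun b _ =>
      ⟨opair _ b, rfl, fun _ h => h⟩
    exact ⟨s, (hc s).2 ⟨_, code_mem_range x, hs⟩, (hs _).2 ⟨_, code_mem_range y, rfl⟩⟩

@[fun_prop]
theorem Internal.exists [IsSet M β] {P : α → β → Prop}
    (hP : Internal M (fun p : α × β => P p.1 p.2)) : Internal M (fun x => ∃ y, P x y) := by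
  obtain ⟨F, hF, hP⟩ := internal_iff_defPred.1 hP
  refine internal_of_defPred (fun a => ∃ b, b ∈ range M β ∧ F (opair a b)) (by fun_prop)
    fun x => ?_
  constructor
  · rintro ⟨b, hb, h⟩
    obtain ⟨y, rfl⟩ := mem_range.1 hb
    exact ⟨y, (hP (x, y)).1 h⟩
  · rintro ⟨y, h⟩
    exact ⟨Coded.code y, code_mem_range y, (hP (x, y)).2 h⟩

theorem Internal.forall [IsSet M β] {P : α → β → Prop}
    (hP : Internal M (fun p : α × β => P p.1 p.2)) : Internal M (fun x => ∀ y, P x y) := by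
  simp only [forall_iff_not_exists_not]
  fun_prop

@[fun_prop]
theorem Internal.apply {F : α → IFun M β γ} {g : α → β} (hF : Internal M F)
    (hg : Internal M g) : Internal M (fun x => F x (g x)) := by
  obtain ⟨G, hG, hF⟩ := internal_iff_def.1 hF
  obtain ⟨H, hH, hg⟩ := internal_iff_def.1 hg
  refine internal_of_def (fun p => ∃ b c, G (p.1, b) ∧ H (p.1, c) ∧ opair c p.2 ∈ b)
    (by fun_prop) fun x b => ?_
  simp [hF, hg, codedIFun_code, IFun.opair_mem_graph]

/-- The code of `F x` is its graph. By extensionality a set is this graph as soon as it has the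
right elements, and that condition is definable from the two-variable function. -/
theorem Internal.curry [IsSet M β] {F : α → IFun M β γ}
    (hF : Internal M (fun p : α × β => F p.1 p.2)) : Internal M F := by
  obtain ⟨G, hG, hF⟩ := internal_iff_def.1 hF
  refine internal_of_def (fun p => ∀ z, z ∈ p.2 ↔ ∃ b, b ∈ range M β ∧ ∃ c, z = opair b c ∧
    G (opair p.1 b, c)) (by simp only [forall_iff_not_exists_not]; fun_prop) fun x g => ?_
  have key : ∀ z, z ∈ (F x).graph ↔ ∃ b, b ∈ range M β ∧ ∃ c, z = opair b c ∧
      G (opair (Coded.code x) b, c) := by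
    intro z
    rw [IFun.mem_graph]
    constructor
    · rintro ⟨y, rfl⟩
      exact ⟨_, code_mem_range y, _, rfl, (hF (x, y) _).2 rfl⟩
    · rintro ⟨b, hb, c, rfl, h⟩
      obtain ⟨y, rfl⟩ := mem_range.1 hb
      exact ⟨y, by rw [(hF (x, y) c).1 h]; rfl⟩
  constructor
  · exact fun h => ModelsZF.extensionality _ _ fun z => (h z).trans (key z).symm
  · rintro rfl
    exact key

/-- Functions obtained outside the model by `choose` become internal in this way, once an internal
relation pins down their values. -/
theorem Internal.of_graph [IsSet M β] {f : α → β}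
    (hf : Internal M (fun p : α × β => f p.1 = p.2)) : Internal M f := by
  obtain ⟨Q, hQ, hf⟩ := internal_iff_defPred.1 hf
  refine internal_of_def (fun p => p.2 ∈ range M β ∧ Q (opair p.1 p.2)) (by fun_prop)
    fun x b => ?_
  constructor
  · rintro ⟨hb, h⟩
    obtain ⟨y, rfl⟩ := mem_range.1 hb
    rw [(hf (x, y)).1 h]
  · rintro rfl
    exact ⟨code_mem_range _, (hf (x, f x)).2 rfl⟩

@[fun_prop]
theorem Internal.ite {P : α → Prop} [DecidablePred P] {f g : α → β} (hP : Internal M P)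
    (hf : Internal M f) (hg : Internal M g) : Internal M (fun x => if P x then f x else g x) := by
  obtain ⟨Q, hQ, hP⟩ := internal_iff_defPred.1 hP
  obtain ⟨F, hF, hf⟩ := internal_iff_def.1 hf
  obtain ⟨G, hG, hg⟩ := internal_iff_def.1 hg
  refine internal_of_def (fun p => Q p.1 ∧ F p ∨ ¬ Q p.1 ∧ G p) (by fun_prop) fun x b => ?_
  by_cases h : P x <;> simp [hP, hf, hg, h]

/-! ### Sets of the model -/

instance isSetEl (a : M) : IsSet M (El a) :=
  ⟨a, fun z => ⟨fun h => ⟨⟨z, h⟩, rfl⟩, by rintro ⟨x, rfl⟩; exact x.2⟩⟩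

instance isSetPow (a : M) : IsSet M (Pow a) := by
  obtain ⟨c, hc⟩ := ModelsZF.powerset a
  exact ⟨c, fun z => (hc z).trans ⟨fun h => ⟨⟨z, h⟩, rfl⟩, by rintro ⟨x, rfl⟩; exact x.2⟩⟩

theorem isSet_of_defPred {β : Type*} [Coded M β] (P : M → Prop) (hP : DefPred M P) (a : M)
    (h : ∀ z, z ∈ a ∧ P z ↔ ∃ x : β, z = code x) : IsSet M β := by
  obtain ⟨c, hc⟩ := exists_separation hP a
  exact ⟨c, fun z => (hc z).trans (h z)⟩

instance isSetProp : IsSet M Prop := by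
  refine ⟨succ (succ (empty M)), fun z => ?_⟩
  simp only [mem_succ, not_mem_empty, false_or]
  constructor
  · rintro (rfl | rfl)
    · exact ⟨False, (code_false id).symm⟩
    · exact ⟨True, (code_true trivial).symm⟩
  · rintro ⟨p, rfl⟩
    by_cases hp : p
    · exact Or.inr (code_true hp)
    · exact Or.inl (code_false hp)

theorem isSet_subtype {p : α → Prop} (hp : Internal M p) : IsSet M (Subtype p) := by
  obtain ⟨Q, hQ, hp⟩ := internal_iff_defPred.1 hp
  refine isSet_of_defPred Q hQ (range M α) fun z => ?_
  constructor
  · rintro ⟨hz, h⟩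
    obtain ⟨x, rfl⟩ := mem_range.1 hz
    exact ⟨⟨x, (hp x).1 h⟩, rfl⟩
  · rintro ⟨⟨x, h⟩, rfl⟩
    exact ⟨code_mem_range x, (hp x).2 h⟩

instance isSetIFun [IsSet M β] : IsSet M (IFun M α β) := by
  obtain ⟨c, hc⟩ := ModelsZF.powerset (range M (α × β))
  refine isSet_of_defPred (fun g => ∀ a, a ∈ range M α → ∃ b, opair a b ∈ g ∧
      ∀ b', opair a b' ∈ g → b' = b)
    (by simp only [forall_iff_not_exists_not, imp_iff_not_or]; fun_prop) c fun g => ?_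
  rw [hc]
  constructor
  · rintro ⟨hg, h⟩
    -- This choice is external but harmless: the values are unique, and the graph `g` is already a
    -- set of the model.
    choose! f hf hf' using h
    have hb : ∀ x : α, ∃ y : β, f (code x) = code y := fun x => by
      obtain ⟨⟨x', y⟩, h⟩ := mem_range.1 (hg _ (hf _ (code_mem_range x)))
      exact ⟨y, (opair_inj h).2⟩
    choose k hk using hb
    refine ⟨⟨k, g, fun z => ⟨fun hz => ?_, ?_⟩⟩, rfl⟩
    · obtain ⟨⟨x, y⟩, rfl⟩ := mem_range.1 (hg _ hz)
      refine ⟨x, ?_⟩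
      rw [← hk, ← hf' _ (code_mem_range x) _ hz]
      rfl
    · rintro ⟨x, rfl⟩
      rw [← hk]
      exact hf _ (code_mem_range x)
  · rintro ⟨g, rfl⟩
    refine ⟨fun z hz => ?_, fun a ha => ?_⟩
    · obtain ⟨x, rfl⟩ := (g.mem_graph z).1 hz
      exact mem_range.2 ⟨(x, g x), rfl⟩
    · obtain ⟨x, rfl⟩ := mem_range.1 ha
      exact ⟨code (g x), (g.opair_mem_graph x _).2 rfl, fun b hb => (g.opair_mem_graph x b).1 hb⟩

/-- The subset of `a` defined by an internal predicate. -/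
noncomputable def Pow.mk {a : M} (P : El a → Prop) : Pow a :=
  open Classical in
  if h : ∃ s : Pow a, ∀ x : El a, x.1 ∈ s.1 ↔ P x then h.choose else
    ⟨empty M, fun x hx => (not_mem_empty x hx).elim⟩

theorem Pow.exists_mk {a : M} {P : El a → Prop} (hP : Internal M P) :
    ∃ s : Pow a, ∀ x : El a, x.1 ∈ s.1 ↔ P x := by
  obtain ⟨Q, hQ, hP⟩ := internal_iff_defPred.1 hP
  obtain ⟨c, hc⟩ := exists_separation hQ a
  exact ⟨⟨c, fun x hx => ((hc x).1 hx).1⟩, fun x => by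
    rw [hc, ← hP]
    exact and_iff_right x.2⟩

theorem Pow.mem_mk {a : M} {P : El a → Prop} (hP : Internal M P) (x : El a) :
    x.1 ∈ (Pow.mk P).1 ↔ P x := by
  have h := Pow.exists_mk hP
  rw [Pow.mk, dif_pos h]
  exact h.choose_spec x

theorem Pow.ext {a : M} {s t : Pow a} (h : ∀ x : El a, x.1 ∈ s.1 ↔ x.1 ∈ t.1) : s = t :=
  Subtype.ext <| ModelsZF.extensionality _ _ fun x =>
    ⟨fun hx => (h ⟨x, s.2 x hx⟩).1 hx, fun hx => (h ⟨x, t.2 x hx⟩).2 hx⟩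

theorem Internal.pow_of_mem {a : M} {f : α → Pow a}
    (hf : Internal M (fun p : α × El a => p.2.1 ∈ (f p.1).1)) : Internal M f := by
  apply Internal.of_graph
  have : ∀ p : α × Pow a, f p.1 = p.2 ↔ ∀ x : El a, x.1 ∈ (f p.1).1 ↔ x.1 ∈ p.2.1 :=
    fun p => ⟨fun h x => by rw [h], Pow.ext⟩
  simp only [this]
  -- Membership in `f x` is hidden behind a predicate `Q` known to be internal; otherwise its
  -- internality would be sought from that of `f`, which is the goal.
  obtain ⟨Q, hQ⟩ : ∃ Q : α × El a → Prop, Internal M Q ∧ ∀ x y, Q (x, y) ↔ y.1 ∈ (f x).1 :=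
    ⟨_, hf, fun _ _ => Iff.rfl⟩
  simp only [← hQ.2]
  have := hQ.1
  apply Internal.forall
  fun_prop

end Internal

/-! ### Natural numbers and finite sets -/

section Finite

variable {M : Type u} [Membership M M] [ModelsZF M]

theorem exists_isInductive (M : Type u) [Membership M M] [ModelsZF M] : ∃ c : M, IsInductive c := by
  obtain ⟨c, ⟨e, he, h0⟩, hs⟩ := ModelsZF.infinity (M := M)
  refine ⟨c, ?_, fun x hx => ?_⟩
  · rwa [ModelsZF.extensionality (empty M) e
      fun x => ⟨fun h => (not_mem_empty x h).elim, fun h => (h0 x h).elim⟩]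
  · obtain ⟨y, hy, h⟩ := hs x hx
    rwa [← eq_succ_iff.2 h]

instance isSetOmega : IsSet M (Omega M) := by
  obtain ⟨c, hc⟩ := exists_isInductive M
  refine isSet_of_defPred (fun n => ∀ c : M, IsInductive c → n ∈ c) ?_ c fun z => ?_
  · simp only [IsInductive, forall_iff_not_exists_not, imp_iff_not_or]
    fun_prop
  · exact ⟨fun h => ⟨⟨z, h.2⟩, rfl⟩, by rintro ⟨n, rfl⟩; exact ⟨n.2 c hc, n.2⟩⟩

theorem Omega.induction {P : Omega M → Prop} (hP : Internal M P) (h0 : P (Omega.zero M))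
    (hs : ∀ n, P n → P n.succ) (n : Omega M) : P n := by
  obtain ⟨Q, hQ, hP⟩ := internal_iff_defPred.1 hP
  obtain ⟨c, hc⟩ := exists_separation hQ (range M (Omega M))
  have : n.1 ∈ c := n.2 c ⟨(hc _).2 ⟨code_mem_range (Omega.zero M), (hP _).2 h0⟩, fun x hx => by
    obtain ⟨hx, hx'⟩ := (hc x).1 hx
    obtain ⟨m, rfl⟩ := mem_range.1 hx
    exact (hc _).2 ⟨code_mem_range m.succ, (hP m.succ).2 (hs m ((hP m).1 hx'))⟩⟩
  exact (hP n).1 ((hc _).1 this).2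

theorem not_mem_self (a : M) : a ∉ a := by
  intro ha
  obtain ⟨x, hx, h⟩ := ModelsZF.foundation (upair a a) ⟨a, mem_upair.2 (Or.inl rfl)⟩
  obtain rfl : x = a := by simpa [mem_upair] using hx
  exact h x ha hx

/-- `g` is the graph of a bijection from `a` to `b`. -/
def IsBijGraph (g a b : M) : Prop :=
  (∀ x, x ∈ a → ∃ y, y ∈ b ∧ opair x y ∈ g ∧ ∀ y', opair x y' ∈ g → y' = y) ∧
  (∀ y, y ∈ b → ∃ x, x ∈ a ∧ opair x y ∈ g ∧ ∀ x', opair x' y ∈ g → x' = x)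

theorem exists_bijective_of_isBijGraph {g a b : M} (h : IsBijGraph g a b) :
    ∃ e : IFun M (El a) (El b), Function.Bijective e := by
  have h1 : ∀ x : El a, ∃ y : El b, opair x.1 y.1 ∈ g ∧ ∀ y', opair x.1 y' ∈ g → y' = y.1 :=
    fun x => by
      obtain ⟨y, hy, h⟩ := h.1 x.1 x.2
      exact ⟨⟨y, hy⟩, h⟩
  choose f hf hf' using h1
  have hi : Internal M f := internal_of_def (fun p => opair p.1 p.2 ∈ g) (by fun_prop)
    fun x b => ⟨hf' x b, by rintro rfl; exact hf x⟩
  refine ⟨hi.toIFun, fun x x' hx => ?_, fun y => ?_⟩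
  · simp only [Internal.toIFun_apply] at hx
    obtain ⟨z, _, _, hz⟩ := h.2 (f x).1 (f x).2
    exact Subtype.ext ((hz _ (hf x)).trans (hz _ (hx ▸ hf x')).symm)
  · obtain ⟨x, hx, hxy, _⟩ := h.2 y.1 y.2
    exact ⟨⟨x, hx⟩, Subtype.ext (by simpa using (hf' ⟨x, hx⟩ _ hxy).symm)⟩

theorem isBijGraph_of_bijective {a b : M} (e : IFun M (El a) (El b))
    (he : Function.Bijective e) : IsBijGraph e.graph a b := by
  refine ⟨fun x hx => ⟨(e ⟨x, hx⟩).1, (e ⟨x, hx⟩).2, (e.opair_mem_graph ⟨x, hx⟩ _).2 rfl,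
    fun y' hy => (e.opair_mem_graph ⟨x, hx⟩ _).1 hy⟩, fun y hy => ?_⟩
  obtain ⟨x, hx⟩ := he.2 ⟨y, hy⟩
  refine ⟨x.1, x.2, (e.opair_mem_graph x _).2 (by rw [hx]; rfl), fun x' hx' => ?_⟩
  obtain ⟨z, hz⟩ := (e.mem_graph _).1 hx'
  obtain ⟨h1, h2⟩ := opair_inj hz
  have : e z = ⟨y, hy⟩ := Subtype.ext h2.symm
  rw [h1, he.1 (this.trans hx.symm)]
  rfl

/-- Here the quantifiers range over sets of the model rather than over bundled functions, which
exhibits finiteness as a first-order definable property. -/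
theorem isFin_iff {a : M} : IsFin a ↔ ∃ n : M, n ∈ range M (Omega M) ∧ ∃ g, IsBijGraph g n a := by
  constructor
  · rintro ⟨n, e, he⟩
    exact ⟨n.1, code_mem_range n, e.graph, isBijGraph_of_bijective e he⟩
  · rintro ⟨_, hn, g, hg⟩
    obtain ⟨n, rfl⟩ := mem_range.1 hn
    exact ⟨n, exists_bijective_of_isBijGraph hg⟩

theorem internal_isFin (a : M) : Internal M (fun s : Pow a => IsFin s.1) :=
  internal_of_defPred (fun s => IsFin s) (by
    simp only [isFin_iff, IsBijGraph, forall_iff_not_exists_not, imp_iff_not_or]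
    fun_prop) fun _ => Iff.rfl

instance isSetFinPow (a : M) : IsSet M (FinPow a) := isSet_subtype (internal_isFin a)

theorem isFin_empty : IsFin (empty M) :=
  isFin_iff.2 ⟨empty M, code_mem_range (Omega.zero M), empty M,
    fun x hx => (not_mem_empty x hx).elim, fun x hx => (not_mem_empty x hx).elim⟩

theorem isFin_of_insert {s t x : M} (hs : IsFin s) (ht : ∀ y, y ∈ t ↔ y ∈ s ∨ y = x) :
    IsFin t := by
  by_cases hx : x ∈ s
  · rwa [ModelsZF.extensionality t s fun y => by rw [ht]; exact ⟨fun h => h.elim id (· ▸ hx), Or.inl⟩]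
  · obtain ⟨n, e, he⟩ := hs
    obtain ⟨h1, h2⟩ := isBijGraph_of_bijective e he
    have hd : ∀ i y, opair i y ∈ e.graph → i ∈ n.1 ∧ y ∈ s := fun i y h => by
      obtain ⟨z, hz⟩ := (e.mem_graph _).1 h
      obtain ⟨rfl, rfl⟩ := opair_inj hz
      exact ⟨z.2, (e z).2⟩
    -- The enumeration is extended by the pair `(n, x)`. It stays bijective because `n ∉ n` and `x ∉
    -- s`.
    obtain ⟨p, hp⟩ := ModelsZF.pairing (opair n.1 x) (opair n.1 x)
    obtain ⟨q, hq⟩ := ModelsZF.pairing e.graph p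
    obtain ⟨g, hg⟩ := ModelsZF.union q
    have hg : ∀ i y, opair i y ∈ g ↔ opair i y ∈ e.graph ∨ i = n.1 ∧ y = x := fun i y => by
      rw [hg]
      simp only [hq, or_and_right, exists_or, exists_eq_left, hp, or_self]
      exact or_congr Iff.rfl ⟨opair_inj, by rintro ⟨rfl, rfl⟩; rfl⟩
    refine isFin_iff.2 ⟨n.succ.1, code_mem_range n.succ, g, fun i hi => ?_, fun y hy => ?_⟩
    · rcases mem_succ.1 hi with hi | rfl
      · obtain ⟨y, hy, hiy, h⟩ := h1 i hi
        refine ⟨y, (ht y).2 (Or.inl hy), (hg _ _).2 (Or.inl hiy), fun y' hy' => ?_⟩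
        rcases (hg _ _).1 hy' with h' | ⟨rfl, _⟩
        · exact h y' h'
        · exact (not_mem_self _ hi).elim
      · refine ⟨x, (ht x).2 (Or.inr rfl), (hg _ _).2 (Or.inr ⟨rfl, rfl⟩), fun y' hy' => ?_⟩
        rcases (hg _ _).1 hy' with h' | ⟨_, rfl⟩
        · exact (not_mem_self _ (hd _ _ h').1).elim
        · rfl
    · rcases (ht y).1 hy with hy | rfl
      · obtain ⟨i, hi, hiy, h⟩ := h2 y hy
        refine ⟨i, mem_succ.2 (Or.inl hi), (hg _ _).2 (Or.inl hiy), fun i' hi' => ?_⟩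
        rcases (hg _ _).1 hi' with h' | ⟨_, rfl⟩
        · exact h i' h'
        · exact (hx hy).elim
      · refine ⟨n.1, mem_succ.2 (Or.inr rfl), (hg _ _).2 (Or.inr ⟨rfl, rfl⟩), fun i' hi' => ?_⟩
        rcases (hg _ _).1 hi' with h' | ⟨rfl, _⟩
        · exact (hx (hd _ _ h').2).elim
        · rfl

/-! ### Finite subsets of a set of the model -/

variable {X : M}

instance memPow : Membership (El X) (Pow X) := ⟨fun s x => x.1 ∈ s.1⟩

instance memFinPow : Membership (El X) (FinPow X) := ⟨fun F x => x.1 ∈ F.1.1⟩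

instance subsetFinPow : HasSubset (FinPow X) := ⟨fun F G => ∀ x : El X, x ∈ F → x ∈ G⟩

theorem FinPow.subset_iff {F G : FinPow X} : F ⊆ G ↔ ∀ x : El X, x ∈ F → x ∈ G := Iff.rfl

@[ext]
theorem FinPow.ext {F G : FinPow X} (h : ∀ x : El X, x ∈ F ↔ x ∈ G) : F = G :=
  Subtype.ext (Pow.ext h)

theorem FinPow.Subset.antisymm {F G : FinPow X} (h : F ⊆ G) (h' : G ⊆ F) : F = G :=
  FinPow.ext fun x => ⟨h x, h' x⟩

theorem FinPow.Subset.refl (F : FinPow X) : F ⊆ F := fun _ h => h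

theorem FinPow.Subset.trans {F G H : FinPow X} (h : F ⊆ G) (h' : G ⊆ H) : F ⊆ H :=
  fun x hx => h' x (h x hx)

variable {α : Type v} [Coded M α] [IsSet M α]

@[fun_prop]
theorem Internal.memPow {f : α → El X} {F : α → Pow X} (hf : Internal M f) (hF : Internal M F) :
    Internal M (fun a => f a ∈ F a) :=
  Internal.mem (f := fun a => (f a).1) (g := fun a => (F a).1) (by fun_prop) (by fun_prop)

@[fun_prop]
theorem Internal.memFinPow {f : α → El X} {F : α → FinPow X} (hf : Internal M f)
    (hF : Internal M F) : Internal M (fun a => f a ∈ F a) :=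
  Internal.memPow (F := fun a => (F a).1) hf (by fun_prop)

@[fun_prop]
theorem Internal.subset {F G : α → FinPow X} (hF : Internal M F)
    (hG : Internal M G) : Internal M (fun a => F a ⊆ G a) := by
  simp only [FinPow.subset_iff, forall_iff_not_exists_not, imp_iff_not_or]
  fun_prop

theorem FinPow.exists_empty (X : M) : ∃ F : FinPow X, ∀ x : El X, x ∉ F :=
  ⟨⟨⟨empty M, fun x hx => (not_mem_empty x hx).elim⟩, isFin_empty⟩, fun x => not_mem_empty x.1⟩

theorem FinPow.exists_insert (x : El X) (F : FinPow X) :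
    ∃ G : FinPow X, ∀ y : El X, y ∈ G ↔ y = x ∨ y ∈ F := by
  obtain ⟨s, hs⟩ := Pow.exists_mk (M := M) (P := fun y : El X => y = x ∨ y ∈ F) (by fun_prop)
  refine ⟨⟨s, isFin_of_insert (x := x.1) F.2 fun y => ?_⟩, hs⟩
  constructor
  · intro hy
    rcases (hs ⟨y, s.2 y hy⟩).1 hy with rfl | h
    · exact Or.inr rfl
    · exact Or.inl h
  · rintro (hy | rfl)
    · exact (hs ⟨y, F.1.2 y hy⟩).2 (Or.inr hy)
    · exact (hs x).2 (Or.inl rfl)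

noncomputable instance emptyFinPow : EmptyCollection (FinPow X) := ⟨(FinPow.exists_empty X).choose⟩

noncomputable instance insertFinPow : Insert (El X) (FinPow X) :=
  ⟨fun x F => (FinPow.exists_insert x F).choose⟩

theorem FinPow.not_mem_empty (x : El X) : x ∉ (∅ : FinPow X) := (FinPow.exists_empty X).choose_spec x

theorem FinPow.mem_insert {x y : El X} {F : FinPow X} : y ∈ insert x F ↔ y = x ∨ y ∈ F :=
  (FinPow.exists_insert x F).choose_spec y

theorem FinPow.empty_subset (F : FinPow X) : ∅ ⊆ F := fun x hx => (not_mem_empty x hx).elim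

theorem FinPow.insert_eq_of_mem {x : El X} {F : FinPow X} (hx : x ∈ F) : insert x F = F :=
  FinPow.ext fun y => by
    rw [mem_insert]
    exact ⟨fun h => h.elim (· ▸ hx) id, Or.inr⟩

theorem Internal.finPow_of_mem {f : α → FinPow X}
    (hf : Internal M (fun p : α × El X => p.2 ∈ f p.1)) : Internal M f :=
  Internal.of_val (Internal.pow_of_mem hf)

@[fun_prop]
theorem Internal.insert {f : α → El X} {F : α → FinPow X} (hf : Internal M f)
    (hF : Internal M F) : Internal M (fun a => insert (f a) (F a)) := by
  apply Internal.finPow_of_mem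
  simp only [FinPow.mem_insert]
  fun_prop

/-- Induction on finite sets along a given enumeration. -/
theorem image_induction {n : Omega M} {F : M} (hF : ∀ x, x ∈ F → x ∈ X)
    (e : IFun M (El n.1) (El F)) {P : Omega M → FinPow X → Prop}
    (hP : Internal M (fun p : Omega M × FinPow X => P p.1 p.2)) (h0 : P (Omega.zero M) ∅)
    (hs : ∀ (i : Omega M) (G : FinPow X) (hi : i.1 ∈ n.1), P i G →
      (∀ x : El X, x ∈ G ↔ ∃ j : El n.1, j.1 ∈ i.1 ∧ (e j).1 = x.1) →
      P i.succ (insert ⟨(e ⟨i.1, hi⟩).1, hF _ (e ⟨i.1, hi⟩).2⟩ G))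
    (hs' : ∀ (i : Omega M) (G : FinPow X), i.1 ∉ n.1 → P i G → P i.succ G) (i : Omega M) :
    ∃ G : FinPow X, (∀ x : El X, x ∈ G ↔ ∃ j : El n.1, j.1 ∈ i.1 ∧ (e j).1 = x.1) ∧ P i G := by
  have he := e.internal
  -- The induction runs through all natural numbers of the model. Once `i` is no longer an element
  -- of `n`, the image of `i` under `e` stops growing, and `hs'` covers these stages.
  refine Omega.induction (P := fun i => ∃ G : FinPow X,
    (∀ x : El X, x ∈ G ↔ ∃ j : El n.1, j.1 ∈ i.1 ∧ (e j).1 = x.1) ∧ P i G) ?_ ?_ ?_ i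
  · simp only [forall_iff_not_exists_not]
    fun_prop
  · exact ⟨∅, fun x => ⟨fun h => (FinPow.not_mem_empty x h).elim,
      fun ⟨j, hj, _⟩ => (ZFModel.not_mem_empty j.1 hj).elim⟩, h0⟩
  · rintro i ⟨G, hG, hi⟩
    by_cases hin : i.1 ∈ n.1
    · refine ⟨_, fun x => ?_, hs i G hin hi hG⟩
      rw [FinPow.mem_insert, hG]
      constructor
      · rintro (rfl | ⟨j, hj, h⟩)
        · exact ⟨⟨i.1, hin⟩, mem_succ.2 (Or.inr rfl), rfl⟩
        · exact ⟨j, mem_succ.2 (Or.inl hj), h⟩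
      · rintro ⟨j, hj, h⟩
        rcases mem_succ.1 hj with hj | hj
        · exact Or.inr ⟨j, hj, h⟩
        · obtain rfl : j = ⟨i.1, hin⟩ := Subtype.ext hj
          exact Or.inl (Subtype.ext h.symm)
    · refine ⟨G, fun x => ?_, hs' i G hin hi⟩
      rw [hG]
      constructor
      · rintro ⟨j, hj, h⟩
        exact ⟨j, mem_succ.2 (Or.inl hj), h⟩
      · rintro ⟨j, hj, h⟩
        rcases mem_succ.1 hj with hj | hj
        · exact ⟨j, hj, h⟩
        · exact (hin (hj ▸ j.2)).elim

/-- An enumeration of `F` is followed up to stage `n`, where its image is all of `F`; a point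
already present leaves the set unchanged. -/
theorem FinPow.induction {P : FinPow X → Prop} (hP : Internal M P) (h0 : P ∅)
    (hs : ∀ x F, x ∉ F → P F → P (insert x F)) (F : FinPow X) : P F := by
  obtain ⟨n, e, he⟩ := F.2
  obtain ⟨G, hG, h⟩ := image_induction F.1.2 e (P := fun _ G => P G) (by fun_prop) h0
    (fun i G hi h _ => by
      by_cases hx : (⟨(e ⟨i.1, hi⟩).1, F.1.2 _ (e ⟨i.1, hi⟩).2⟩ : El X) ∈ G
      · rwa [insert_eq_of_mem hx]
      · exact hs _ _ hx h) (fun _ _ _ h => h) n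
  convert h
  ext x
  rw [hG]
  constructor
  · intro hx
    obtain ⟨j, hj⟩ := he.2 ⟨x.1, hx⟩
    exact ⟨j, j.2, congrArg Subtype.val hj⟩
  · rintro ⟨j, _, hj⟩
    exact (congrArg (· ∈ F.1.1) hj).mp (e j).2

theorem FinPow.exists_sep (F : FinPow X) {P : El X → Prop} (hP : Internal M P) :
    ∃ G : FinPow X, ∀ x : El X, x ∈ G ↔ x ∈ F ∧ P x := by
  refine FinPow.induction (P := fun F => ∃ G : FinPow X, ∀ x : El X, x ∈ G ↔ x ∈ F ∧ P x)
    ?_ ?_ ?_ F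
  · simp only [forall_iff_not_exists_not]
    fun_prop
  · exact ⟨∅, fun x => by simp [FinPow.not_mem_empty]⟩
  · rintro x F _ ⟨G, hG⟩
    by_cases hx : P x
    · refine ⟨insert x G, fun y => ?_⟩
      rw [mem_insert, mem_insert, hG]
      by_cases h : y = x <;> simp [h, hx]
    · refine ⟨G, fun y => ?_⟩
      rw [mem_insert, hG]
      by_cases h : y = x <;> simp [h, hx]

open Classical in
/-- The elements of the finite set `F` that satisfy the internal predicate `P`. -/
noncomputable def FinPow.sep (F : FinPow X) (P : El X → Prop) : FinPow X :=
  if h : ∃ G : FinPow X, ∀ x : El X, x ∈ G ↔ x ∈ F ∧ P x then h.choose else ∅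

theorem FinPow.mem_sep {F : FinPow X} {P : El X → Prop} (hP : Internal M P) {x : El X} :
    x ∈ F.sep P ↔ x ∈ F ∧ P x := by
  have h := FinPow.exists_sep F hP
  rw [sep, dif_pos h]
  exact h.choose_spec x

@[fun_prop]
theorem Internal.sep {F : α → FinPow X} {P : α → El X → Prop} (hF : Internal M F)
    (hP : Internal M (fun p : α × El X => P p.1 p.2)) :
    Internal M (fun a => (F a).sep (P a)) := by
  apply Internal.finPow_of_mem
  have : ∀ a, Internal M (P a) := fun a =>
    hP.comp (f := fun y : El X => (a, y)) (by fun_prop)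
  simp only [FinPow.mem_sep (this _)]
  fun_prop

/-- `F` without `x`. -/
noncomputable def FinPow.erase (F : FinPow X) (x : El X) : FinPow X := F.sep (fun y => ¬ y = x)

theorem FinPow.mem_erase {F : FinPow X} {x y : El X} : y ∈ F.erase x ↔ y ∈ F ∧ ¬ y = x :=
  FinPow.mem_sep (P := fun y => ¬ y = x) (by fun_prop)

@[fun_prop]
theorem Internal.erase {F : α → FinPow X} {f : α → El X} (hF : Internal M F)
    (hf : Internal M f) : Internal M (fun a => (F a).erase (f a)) := by
  unfold FinPow.erase
  fun_prop

theorem FinPow.exists_union (F G : FinPow X) :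
    ∃ H : FinPow X, ∀ x : El X, x ∈ H ↔ x ∈ F ∨ x ∈ G := by
  refine FinPow.induction (P := fun F => ∃ H : FinPow X, ∀ x : El X, x ∈ H ↔ x ∈ F ∨ x ∈ G)
    ?_ ?_ ?_ F
  · simp only [forall_iff_not_exists_not]
    fun_prop
  · exact ⟨G, fun x => by simp [FinPow.not_mem_empty]⟩
  · rintro x F _ ⟨H, hH⟩
    exact ⟨insert x H, fun y => by rw [mem_insert, mem_insert, hH, or_assoc]⟩

noncomputable instance unionFinPow : Union (FinPow X) := ⟨fun F G => (F.exists_union G).choose⟩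

theorem FinPow.mem_union {F G : FinPow X} {x : El X} : x ∈ F ∪ G ↔ x ∈ F ∨ x ∈ G :=
  (F.exists_union G).choose_spec x

@[fun_prop]
theorem Internal.union {F G : α → FinPow X} (hF : Internal M F) (hG : Internal M G) :
    Internal M (fun a => F a ∪ G a) := by
  apply Internal.finPow_of_mem
  simp only [FinPow.mem_union]
  fun_prop

/-- A union of finitely many finite sets is finite. -/
theorem FinPow.exists_biUnion {Y : M} (F : FinPow Y) {E : El Y → El X → Prop}
    (hE : Internal M (fun p : El Y × El X => E p.1 p.2))
    (h : ∀ y ∈ F, ∃ G : FinPow X, ∀ x, E y x → x ∈ G) :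
    ∃ G : FinPow X, ∀ y ∈ F, ∀ x, E y x → x ∈ G := by
  revert h
  -- The induction replaces a simultaneous choice of a bound `G` for every `y`.
  refine FinPow.induction (P := fun F => (∀ y : El Y, y ∈ F → ∃ G : FinPow X, ∀ x, E y x → x ∈ G) →
    ∃ G : FinPow X, ∀ y : El Y, y ∈ F → ∀ x, E y x → x ∈ G) ?_ ?_ ?_ F
  · simp only [forall_iff_not_exists_not, imp_iff_not_or]
    fun_prop
  · exact fun _ => ⟨∅, fun y hy => (not_mem_empty y hy).elim⟩
  · intro y F _ ih h
    obtain ⟨G, hG⟩ := ih fun y hy => h y (mem_insert.2 (Or.inr hy))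
    obtain ⟨H, hH⟩ := h y (mem_insert.2 (Or.inl rfl))
    refine ⟨G ∪ H, fun z hz x hx => mem_union.2 ?_⟩
    rcases mem_insert.1 hz with rfl | hz
    · exact Or.inr (hH x hx)
    · exact Or.inl (hG z hz x hx)

end Finite

/-! ### Finite sums -/

section Sum

variable (M : Type u) [Membership M M] [ModelsZF M]

/-- The addition of `A` belongs to the model. -/
class InternalAdd (A : Type*) [Add A] [Coded M A] : Prop where
  internal_add : Internal M (fun p : A × A => p.1 + p.2)

/-- The order of `A` belongs to the model. -/
class InternalLE (A : Type*) [LE A] [Coded M A] : Prop where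
  internal_le : Internal M (fun p : A × A => p.1 ≤ p.2)

variable {M} {X Y : M} {α : Type*} [Coded M α] [IsSet M α]
  {A B : Type*} [Coded M A] [Coded M B] [IsSet M A] [IsSet M B]

@[fun_prop]
theorem Internal.add [Add A] [InternalAdd M A] {f g : α → A} (hf : Internal M f)
    (hg : Internal M g) : Internal M (fun x => f x + g x) :=
  (InternalAdd.internal_add (M := M) (A := A)).comp (hf.prodMk hg)

@[fun_prop]
theorem Internal.le [LE A] [InternalLE M A] {f g : α → A} (hf : Internal M f)
    (hg : Internal M g) : Internal M (fun x => f x ≤ g x) :=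
  (InternalLE.internal_le (M := M) (A := A)).comp (hf.prodMk hg)

@[fun_prop]
theorem Internal.lt [Preorder A] [InternalLE M A] {f g : α → A} (hf : Internal M f)
    (hg : Internal M g) : Internal M (fun x => f x < g x) := by
  simp only [lt_iff_le_not_ge]
  fun_prop

theorem Internal.curry_right {β γ : Type*} [Coded M β] [IsSet M β] [Coded M γ] {f : α → β → γ}
    (hf : Internal M (fun p : α × β => f p.1 p.2)) (a : α) : Internal M (f a) :=
  hf.comp (f := fun y : β => (a, y)) (by fun_prop)

variable [AddCommMonoid A] [InternalAdd M A] [AddCommMonoid B] [InternalAdd M B]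

/-- `s = ∑ x ∈ F, f x`, witnessed by a function `σ` that sends `G` to `∑ x ∈ G, f x` for
`G ⊆ F`. -/
def IsFinSum (F : FinPow X) (f : IFun M (El X) A) (s : A) : Prop :=
  ∃ σ : IFun M (FinPow X) A, σ ∅ = 0 ∧
    (∀ G x, x ∈ F → x ∉ G → σ (insert x G) = σ G + f x) ∧ σ F = s

/-- The witnesses are functions of finite sets instead of enumerations, so induction on `G` gives
uniqueness without any argument about reordering. Agreement is claimed only for `G ⊆ F`, since the
recursion says nothing about points outside `F`. -/
theorem isFinSum_unique {F : FinPow X} {f : IFun M (El X) A} {σ τ : IFun M (FinPow X) A}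
    (h0 : σ ∅ = 0) (hs : ∀ G x, x ∈ F → x ∉ G → σ (insert x G) = σ G + f x)
    (h0' : τ ∅ = 0) (hs' : ∀ G x, x ∈ F → x ∉ G → τ (insert x G) = τ G + f x)
    {G : FinPow X} : G ⊆ F → σ G = τ G := by
  refine FinPow.induction (P := fun G => G ⊆ F → σ G = τ G) ?_ (fun _ => h0.trans h0'.symm) ?_ G
  · simp only [imp_iff_not_or]
    fun_prop
  · intro x G hx ih h
    have hxF := h x (FinPow.mem_insert.2 (Or.inl rfl))
    rw [hs G x hxF hx, hs' G x hxF hx, ih fun y hy => h y (FinPow.mem_insert.2 (Or.inr hy))]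

theorem isFinSum_empty (f : IFun M (El X) A) : IsFinSum ∅ f 0 :=
  ⟨(internal_const (M := M) (0 : A)).toIFun, by simp,
    fun _ x hx => (FinPow.not_mem_empty x hx).elim, by simp⟩

theorem IsFinSum.exists_insert {F : FinPow X} {f : IFun M (El X) A} {s : A} {x : El X}
    (hx : x ∉ F) (h : IsFinSum F f s) : ∃ t, IsFinSum (insert x F) f t := by
  classical
  obtain ⟨σ, h0, hs, -⟩ := h
  -- The old witness ignores `x`, and the term `f x` is added exactly when `x` belongs to `G`.
  have hσ : Internal M (fun G : FinPow X => σ (G.erase x) + if x ∈ G then f x else 0) := by fun_prop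
  refine ⟨_, hσ.toIFun, ?_, fun G y hy hyG => ?_, rfl⟩
  · have : (∅ : FinPow X).erase x = ∅ := by
      ext y
      simp [FinPow.mem_erase, FinPow.not_mem_empty]
    simp [this, h0, FinPow.not_mem_empty]
  · simp only [Internal.toIFun_apply]
    by_cases hyx : y = x
    · subst hyx
      have : (insert y G).erase y = G.erase y := by
        ext z
        rw [FinPow.mem_erase, FinPow.mem_erase, FinPow.mem_insert]
        tauto
      simp [this, FinPow.mem_insert, hyG]
    · have : (insert y G).erase x = insert y (G.erase x) := by
        ext z
        rw [FinPow.mem_erase, FinPow.mem_insert, FinPow.mem_insert, FinPow.mem_erase]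
        constructor
        · tauto
        · rintro (rfl | h)
          · exact ⟨Or.inl rfl, hyx⟩
          · tauto
      have hyF : y ∈ F := (FinPow.mem_insert.1 hy).resolve_left hyx
      have hxy : x ∈ insert y G ↔ x ∈ G := by
        rw [FinPow.mem_insert]
        exact ⟨fun h => h.resolve_left fun h => hyx h.symm, Or.inr⟩
      rw [this, hs _ y hyF fun h => hyG (FinPow.mem_erase.1 h).1]
      simp only [hxy]
      abel

theorem IsFinSum.insert {F : FinPow X} {f : IFun M (El X) A} {s : A} {x : El X}
    (hx : x ∉ F) (h : IsFinSum F f s) : IsFinSum (insert x F) f (s + f x) := by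
  obtain ⟨t, τ, h0, hs, -⟩ := h.exists_insert hx
  obtain ⟨σ, h0', hs', rfl⟩ := h
  have hF : ∀ y, y ∈ F → y ∈ Insert.insert x F := fun y hy => FinPow.mem_insert.2 (Or.inr hy)
  refine ⟨τ, h0, hs, ?_⟩
  rw [hs _ x (FinPow.mem_insert.2 (Or.inl rfl)) hx,
    isFinSum_unique h0 (fun G y hy => hs G y (hF y hy)) h0' hs' (FinPow.Subset.refl F)]

theorem exists_isFinSum (F : FinPow X) (f : IFun M (El X) A) : ∃ s, IsFinSum F f s := by
  refine FinPow.induction (P := fun F => ∃ s, IsFinSum F f s) ?_ ⟨0, isFinSum_empty f⟩ ?_ F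
  · simp only [IsFinSum, forall_iff_not_exists_not, imp_iff_not_or]
    fun_prop
  · rintro x F hx ⟨s, hs⟩
    exact hs.exists_insert hx

theorem IsFinSum.unique {F : FinPow X} {f : IFun M (El X) A} {s t : A} (hs : IsFinSum F f s)
    (ht : IsFinSum F f t) : s = t := by
  obtain ⟨σ, h0, hs, rfl⟩ := hs
  obtain ⟨τ, h0', hs', rfl⟩ := ht
  exact isFinSum_unique h0 hs h0' hs' (FinPow.Subset.refl F)

open Classical in
/-- The sum of the internal function `f` over the finite set `F`. -/
noncomputable def fsum (F : FinPow X) (f : El X → A) : A :=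
  if hf : Internal M f then (exists_isFinSum F hf.toIFun).choose else 0

theorem fsum_eq_iff {F : FinPow X} {f : El X → A} (hf : Internal M f) {s : A} :
    fsum F f = s ↔ IsFinSum F hf.toIFun s := by
  have h := (exists_isFinSum F hf.toIFun).choose_spec
  rw [fsum, dif_pos hf]
  exact ⟨by rintro rfl; exact h, h.unique⟩

theorem fsum_empty {f : El X → A} (hf : Internal M f) : fsum ∅ f = 0 :=
  (fsum_eq_iff hf).2 (isFinSum_empty _)

theorem fsum_insert {f : El X → A} (hf : Internal M f) {F : FinPow X} {x : El X} (hx : x ∉ F) :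
    fsum (insert x F) f = fsum F f + f x := by
  have h := ((fsum_eq_iff hf).1 rfl : IsFinSum F hf.toIFun (fsum F f)).insert hx
  rw [Internal.toIFun_apply] at h
  exact (fsum_eq_iff hf).2 h

@[fun_prop]
theorem Internal.fsum {F : α → FinPow X} {f : α → El X → A} (hF : Internal M F)
    (hf : Internal M (fun p : α × El X => f p.1 p.2)) :
    Internal M (fun a => fsum (F a) (f a)) := by
  have h := hf.curry_right
  have hg : Internal M (fun a => (h a).toIFun) := by
    apply Internal.curry
    simpa using hf
  -- The bundled functions are replaced by one internal family `g`, so that `IsFinSum` becomes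
  -- visibly internal in the parameter `a`.
  obtain ⟨g, hg, hgf⟩ : ∃ g : α → IFun M (El X) A, Internal M g ∧ ∀ a, (h a).toIFun = g a :=
    ⟨_, hg, fun _ => rfl⟩
  apply Internal.of_graph
  simp only [fsum_eq_iff (h _), hgf, IsFinSum, forall_iff_not_exists_not, imp_iff_not_or]
  fun_prop

theorem fsum_congr {f g : El X → A} (hf : Internal M f) (hg : Internal M g) {F : FinPow X} :
    (∀ x, x ∈ F → f x = g x) → fsum F f = fsum F g := by
  refine FinPow.induction (P := fun F => (∀ x, x ∈ F → f x = g x) → fsum F f = fsum F g)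
    ?_ ?_ ?_ F
  · simp only [forall_iff_not_exists_not, imp_iff_not_or]
    fun_prop
  · exact fun _ => by rw [fsum_empty hf, fsum_empty hg]
  · intro x F hx ih h
    rw [fsum_insert hf hx, fsum_insert hg hx, h x (FinPow.mem_insert.2 (Or.inl rfl)),
      ih fun y hy => h y (FinPow.mem_insert.2 (Or.inr hy))]

theorem fsum_map {φ : A → B} (hφ : Internal M φ) (h0 : φ 0 = 0)
    (hadd : ∀ a b, φ (a + b) = φ a + φ b) {f : El X → A} (hf : Internal M f) (F : FinPow X) :
    fsum F (fun x => φ (f x)) = φ (fsum F f) := by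
  refine FinPow.induction (P := fun F => fsum F (fun x => φ (f x)) = φ (fsum F f))
    (by fun_prop) ?_ ?_ F
  · rw [fsum_empty hf, fsum_empty (by fun_prop), h0]
  · intro x F hx ih
    rw [fsum_insert hf hx, fsum_insert (by fun_prop) hx, hadd, ih]

theorem fsum_add {f g : El X → A} (hf : Internal M f) (hg : Internal M g) (F : FinPow X) :
    fsum F (fun x => f x + g x) = fsum F f + fsum F g := by
  refine FinPow.induction (P := fun F => fsum F (fun x => f x + g x) = fsum F f + fsum F g)
    (by fun_prop) ?_ ?_ F
  · rw [fsum_empty hf, fsum_empty hg, fsum_empty (by fun_prop), add_zero]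
  · intro x F hx ih
    rw [fsum_insert hf hx, fsum_insert hg hx, fsum_insert (by fun_prop) hx, ih]
    abel

theorem fsum_zero (F : FinPow X) : fsum F (fun _ => (0 : A)) = 0 := by
  refine FinPow.induction (P := fun F : FinPow X => fsum F (fun _ => (0 : A)) = 0)
    (by fun_prop) (fsum_empty (by fun_prop)) (fun x F hx ih => ?_) F
  rw [fsum_insert (by fun_prop) hx, ih, add_zero]

theorem fsum_eq_zero {f : El X → A} (hf : Internal M f) {F : FinPow X}
    (h : ∀ x, x ∈ F → f x = 0) : fsum F f = 0 :=
  (fsum_congr hf (by fun_prop) h).trans (fsum_zero F)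

theorem fsum_comm {f : El X → El Y → A} (hf : Internal M (fun p : El X × El Y => f p.1 p.2))
    (F : FinPow X) (G : FinPow Y) :
    fsum F (fun x => fsum G (f x)) = fsum G (fun y => fsum F (fun x => f x y)) := by
  have hx := hf.curry_right
  have hy : ∀ y, Internal M (fun x => f x y) := fun y =>
    hf.comp (f := fun x : El X => (x, y)) (by fun_prop)
  have h1 : Internal M (fun x => fsum G (f x)) := by fun_prop
  have h2 : Internal M (fun p : El Y × FinPow X => fsum p.2 (fun x => f x p.1)) :=
    Internal.fsum (by fun_prop) (f := fun (p : El Y × FinPow X) x => f x p.1)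
      (hf.comp (f := fun q : (El Y × FinPow X) × El X => (q.2, q.1.1)) (by fun_prop))
  refine FinPow.induction (P := fun F => fsum F (fun x => fsum G (f x)) =
    fsum G (fun y => fsum F (fun x => f x y))) ?_ ?_ ?_ F
  · refine Internal.eq (by fun_prop) (Internal.fsum (by fun_prop) ?_)
    exact h2.comp (f := fun p : FinPow X × El Y => (p.2, p.1)) (by fun_prop)
  · rw [fsum_empty h1]
    exact (fsum_eq_zero (h2.comp (f := fun y : El Y => (y, ∅)) (by fun_prop))
      fun y _ => fsum_empty (hy y)).symm
  · intro x F hxF ih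
    have h3 := fun F => h2.comp (f := fun y : El Y => (y, F)) (by fun_prop)
    rw [fsum_insert h1 hxF, ih, ← fsum_add (h3 F) (hx x)]
    refine fsum_congr ((h3 F).add (hx x)) (h3 _) fun y _ => ?_
    exact (fsum_insert (hy y) hxF).symm

theorem fsum_erase {f : El X → A} (hf : Internal M f) {F : FinPow X} {x : El X} (hx : x ∈ F) :
    fsum F f = fsum (F.erase x) f + f x := by
  rw [← fsum_insert hf fun h => (FinPow.mem_erase.1 h).2 rfl]
  congr 1
  ext y
  rw [FinPow.mem_insert, FinPow.mem_erase]
  by_cases h : y = x <;> simp [h, hx]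

theorem fsum_eq_single {f : El X → A} (hf : Internal M f) {F : FinPow X} {x : El X} (hx : x ∈ F)
    (h : ∀ y, y ∈ F → y ≠ x → f y = 0) : fsum F f = f x := by
  rw [fsum_erase hf hx, fsum_eq_zero hf fun y hy => h y (FinPow.mem_erase.1 hy).1
    (FinPow.mem_erase.1 hy).2, zero_add]

theorem fsum_subset {f : El X → A} (hf : Internal M f) {F G : FinPow X} (hFG : F ⊆ G)
    (h : ∀ x, x ∈ G → x ∉ F → f x = 0) : fsum F f = fsum G f := by
  have key : fsum (F ∪ G) f = fsum F f := by
    revert h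
    clear hFG
    refine FinPow.induction (P := fun G => (∀ x, x ∈ G → x ∉ F → f x = 0) →
      fsum (F ∪ G) f = fsum F f) ?_ ?_ ?_ G
    · simp only [forall_iff_not_exists_not, imp_iff_not_or]
      fun_prop
    · intro _
      congr 1
      ext x
      simp [FinPow.mem_union, FinPow.not_mem_empty]
    · intro x G hx ih h
      have hG := ih fun y hy => h y (FinPow.mem_insert.2 (Or.inr hy))
      have hU : F ∪ insert x G = insert x (F ∪ G) := by
        ext y
        simp only [FinPow.mem_union, FinPow.mem_insert]
        tauto
      by_cases hxF : x ∈ F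
      · rw [hU, FinPow.insert_eq_of_mem (FinPow.mem_union.2 (Or.inl hxF)), hG]
      · rw [hU, fsum_insert hf fun hxU => (FinPow.mem_union.1 hxU).elim hxF hx, hG,
          h x (FinPow.mem_insert.2 (Or.inl rfl)) hxF, add_zero]
  rw [← key]
  congr 1
  ext x
  rw [FinPow.mem_union]
  exact ⟨fun h => h.elim (hFG x) id, Or.inr⟩

theorem internal_subset_omega (m : M) :
    Internal M (fun i : Omega M => ∀ x : M, x ∈ i.1 → x ∈ m) :=
  internal_of_defPred (fun i => ∀ x : M, x ∈ i → x ∈ m)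
    (by simp only [forall_iff_not_exists_not, imp_iff_not_or]; fun_prop) fun _ => Iff.rfl

/-- Along an enumeration of `F`, the partial sum at stage `i` is the sum over the image of `i`. This
translates the sequential sums of the definitions into the order-free `fsum`. -/
theorem hasSumOver_iff {F : FinPow X} {f : El X → A} (hf : Internal M f) {s : A} :
    HasSumOver F f s ↔ s = fsum F f := by
  constructor
  · rintro ⟨n, e, g, he, h0, hs, rfl⟩
    have hn := internal_subset_omega n.1
    -- The recursion for `g` is available only below `n`, so the claim is restricted to `i ⊆ n`,
    -- that is, to `i ≤ n`.
    have hP : Internal M (fun p : Omega M × FinPow X =>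
        (∀ x : M, x ∈ p.1.1 → x ∈ n.1) → g p.1 = fsum p.2 f) := by
      apply Internal.imp (hn.comp (f := fun p : Omega M × FinPow X => p.1) (by fun_prop))
      fun_prop
    obtain ⟨G, hG, h⟩ := image_induction F.1.2 e
      (P := fun i G => (∀ x : M, x ∈ i.1 → x ∈ n.1) → g i = fsum G f) hP (fun _ => by rw [h0, fsum_empty hf])
      (fun i G hi h hG hin => by
        have hx : (⟨(e ⟨i.1, hi⟩).1, F.1.2 _ (e ⟨i.1, hi⟩).2⟩ : El X) ∉ G := by
          rw [hG]
          rintro ⟨j, hj, h⟩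
          have := he.1 (Subtype.ext h)
          subst this
          exact not_mem_self _ hj
        rw [fsum_insert hf hx, hs i hi, h fun x hx => hin x (mem_succ.2 (Or.inl hx))])
      (fun i G hi _ h => (hi (h i.1 (mem_succ.2 (Or.inr rfl)))).elim) n
    rw [h fun _ h => h]
    congr 1
    ext x
    rw [hG]
    constructor
    · rintro ⟨j, _, hj⟩
      exact (congrArg (· ∈ F.1.1) hj).mp (e j).2
    · intro hx
      obtain ⟨j, hj⟩ := he.2 ⟨x.1, hx⟩
      exact ⟨j, j.2, congrArg Subtype.val hj⟩
  · rintro rfl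
    obtain ⟨n, e, he⟩ := F.2
    have himg : ∀ i : Omega M, ∃ G : FinPow X,
        ∀ x : El X, x ∈ G ↔ ∃ j : El n.1, j.1 ∈ i.1 ∧ (e j).1 = x.1 := fun i => by
      obtain ⟨G, hG, -⟩ := image_induction F.1.2 e (P := fun _ _ => True) (by fun_prop) trivial
        (fun _ _ _ _ _ => trivial) (fun _ _ _ _ => trivial) i
      exact ⟨G, hG⟩
    -- The images are determined by their elements, so the function `img` is internal although it is
    -- chosen externally.
    choose img himg using himg
    have hi : Internal M img := by
      apply Internal.finPow_of_mem
      simp only [himg]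
      fun_prop
    have hg : Internal M (fun i => fsum (img i) f) := by fun_prop
    refine ⟨n, e, hg.toIFun, he, ?_, fun i hi => ?_, ?_⟩
    · rw [Internal.toIFun_apply, ← fsum_empty hf]
      congr 1
      ext x
      rw [himg]
      exact ⟨fun ⟨j, hj, _⟩ => (not_mem_empty j.1 hj).elim,
        fun h => (FinPow.not_mem_empty x h).elim⟩
    · have hx : (⟨(e ⟨i.1, hi⟩).1, F.1.2 _ (e ⟨i.1, hi⟩).2⟩ : El X) ∉ img i := by
        rw [himg]
        rintro ⟨j, hj, h⟩
        have := he.1 (Subtype.ext h)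
        subst this
        exact not_mem_self _ hj
      rw [Internal.toIFun_apply, Internal.toIFun_apply, ← fsum_insert hf hx]
      congr 1
      ext x
      rw [FinPow.mem_insert, himg, himg]
      constructor
      · rintro ⟨j, hj, h⟩
        rcases mem_succ.1 hj with hj | hj
        · exact Or.inr ⟨j, hj, h⟩
        · obtain rfl : j = ⟨i.1, hi⟩ := Subtype.ext hj
          exact Or.inl (Subtype.ext h.symm)
      · rintro (rfl | ⟨j, hj, h⟩)
        · exact ⟨⟨i.1, hi⟩, mem_succ.2 (Or.inr rfl), rfl⟩
        · exact ⟨j, mem_succ.2 (Or.inl hj), h⟩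
    · rw [Internal.toIFun_apply]
      congr 1
      ext x
      rw [himg]
      constructor
      · rintro ⟨j, _, hj⟩
        exact (congrArg (· ∈ F.1.1) hj).mp (e j).2
      · intro hx
        obtain ⟨j, hj⟩ := he.2 ⟨x.1, hx⟩
        exact ⟨j, j.2, congrArg Subtype.val hj⟩

/-! ### Inequalities between finite sums -/

section Order

variable [PartialOrder A] [IsOrderedAddMonoid A] [InternalLE M A]

theorem fsum_le_fsum {f g : El X → A} (hf : Internal M f) (hg : Internal M g) {F : FinPow X} :
    (∀ x, x ∈ F → f x ≤ g x) → fsum F f ≤ fsum F g := by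
  refine FinPow.induction (P := fun F => (∀ x, x ∈ F → f x ≤ g x) → fsum F f ≤ fsum F g)
    ?_ ?_ ?_ F
  · simp only [forall_iff_not_exists_not, imp_iff_not_or]
    fun_prop
  · exact fun _ => by rw [fsum_empty hf, fsum_empty hg]
  · intro x F hx ih h
    rw [fsum_insert hf hx, fsum_insert hg hx]
    exact add_le_add (ih fun y hy => h y (FinPow.mem_insert.2 (Or.inr hy)))
      (h x (FinPow.mem_insert.2 (Or.inl rfl)))

theorem fsum_nonneg {f : El X → A} (hf : Internal M f) {F : FinPow X}
    (h : ∀ x, x ∈ F → 0 ≤ f x) : 0 ≤ fsum F f := by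
  rw [← fsum_zero F]
  exact fsum_le_fsum (by fun_prop) hf h

theorem single_le_fsum {f : El X → A} (hf : Internal M f) {F : FinPow X}
    (h : ∀ x, x ∈ F → 0 ≤ f x) {x : El X} (hx : x ∈ F) : f x ≤ fsum F f := by
  rw [fsum_erase hf hx]
  exact le_add_of_nonneg_left (fsum_nonneg hf fun y hy => h y (FinPow.mem_erase.1 hy).1)

theorem eq_zero_of_fsum_eq_zero {f : El X → A} (hf : Internal M f) {F : FinPow X}
    (h : ∀ x, x ∈ F → 0 ≤ f x) (h0 : fsum F f = 0) {x : El X} (hx : x ∈ F) : f x = 0 :=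
  le_antisymm (h0 ▸ single_le_fsum hf h hx) (h x hx)

theorem fsum_le_of_support {f : El X → A} (hf : Internal M f) {F G : FinPow X}
    (h : ∀ x, 0 ≤ f x) (h0 : ∀ x, x ∉ G → f x = 0) : fsum F f ≤ fsum G f := by
  classical
  -- Neither set need contain the other. Truncating `f` to `F` allows both sums to be taken over `F
  -- ∪ G`, where they are compared termwise.
  have hg : Internal M (fun x => if x ∈ F then f x else 0) := by fun_prop
  have h1 : fsum F f = fsum (F ∪ G) (fun x => if x ∈ F then f x else 0) := by
    rw [← fsum_subset hg (fun x hx => FinPow.mem_union.2 (Or.inl hx)) fun x _ hx => if_neg hx]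
    exact fsum_congr hf hg fun x hx => (if_pos hx).symm
  rw [h1, fsum_subset hf (fun x hx => FinPow.mem_union.2 (Or.inr hx) : G ⊆ F ∪ G)
    fun x _ hx => h0 x hx]
  refine fsum_le_fsum hg hf fun x _ => ?_
  split_ifs
  · exact le_rfl
  · exact h x

end Order

end Sum

/-! ### Dedekind-finiteness of the set of finite subsets -/

section Chain

variable {M : Type u} [Membership M M] [ModelsZF M] {X : M}

/-- An internal family of finite sets has a minimal element below any of its elements. -/
theorem FinPow.exists_minimal {D : FinPow X → Prop} (hD : Internal M D) {F : FinPow X}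
    (hF : D F) : ∃ G, D G ∧ ∀ H, D H → H ⊆ G → G ⊆ H := by
  -- The family changes during the induction, so the induction statement quantifies over it;
  -- bundling `D` in the model keeps that statement internal.
  suffices h : ∀ D : IFun M (FinPow X) Prop, (∃ G, D G ∧ G ⊆ F) →
      ∃ G, D G ∧ G ⊆ F ∧ ∀ H, D H → H ⊆ G → G ⊆ H by
    obtain ⟨G, h1, _, h2⟩ := h hD.toIFun ⟨F, by simpa using hF, Subset.refl F⟩
    exact ⟨G, by simpa using h1, by simpa using h2⟩
  clear hF
  refine FinPow.induction (P := fun F => ∀ D : IFun M (FinPow X) Prop, (∃ G, D G ∧ G ⊆ F) →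
      ∃ G, D G ∧ G ⊆ F ∧ ∀ H, D H → H ⊆ G → G ⊆ H) ?_ ?_ ?_ F
  · simp only [forall_iff_not_exists_not, imp_iff_not_or]
    fun_prop
  · rintro D ⟨G, hG, hG0⟩
    exact ⟨G, hG, hG0, fun H _ _ => Subset.trans hG0 (empty_subset H)⟩
  · rintro x F - ih D ⟨G, hG, hGF⟩
    by_cases hex : ∃ G, D G ∧ G ⊆ F
    · obtain ⟨G, h1, h2, h3⟩ := ih D hex
      exact ⟨G, h1, Subset.trans h2 fun y hy => mem_insert.2 (Or.inr hy), h3⟩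
    -- In the remaining case every member inside `insert x F` contains `x`. Deleting `x` gives a
    -- family with a member inside `F`, to which the induction hypothesis applies.
    have hx : ∀ G, D G → G ⊆ insert x F → x ∈ G := fun G hG hGF => by
      by_contra hx
      refine hex ⟨G, hG, fun y hy => (mem_insert.1 (hGF y hy)).resolve_left ?_⟩
      rintro rfl
      exact hx hy
    have hins : ∀ G : FinPow X, x ∈ G → insert x (G.erase x) = G := fun G hxG => by
      ext y
      rw [mem_insert, mem_erase]
      by_cases h : y = x <;> simp [h, hxG]
    have hD' : Internal M (fun H : FinPow X => x ∉ H ∧ D (insert x H)) := by fun_prop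
    obtain ⟨H, h1, h2, h3⟩ := ih hD'.toIFun ⟨G.erase x, by
      simp only [Internal.toIFun_apply]
      exact ⟨fun h => (mem_erase.1 h).2 rfl, by rwa [hins G (hx G hG hGF)]⟩, fun y hy =>
        (mem_insert.1 (hGF y (mem_erase.1 hy).1)).resolve_left (mem_erase.1 hy).2⟩
    simp only [Internal.toIFun_apply] at h1 h3
    have hHF : insert x H ⊆ insert x F := fun y hy =>
      mem_insert.2 ((mem_insert.1 hy).imp id (h2 y))
    refine ⟨insert x H, h1.2, hHF, fun K hK hKH => ?_⟩
    have hxK := hx K hK (Subset.trans hKH hHF)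
    have := h3 (K.erase x) ⟨fun h => (mem_erase.1 h).2 rfl, by rwa [hins K hxK]⟩ fun y hy =>
      (mem_insert.1 (hKH y (mem_erase.1 hy).1)).resolve_left (mem_erase.1 hy).2
    intro y hy
    rcases mem_insert.1 hy with rfl | hy
    · exact hxK
    · exact (mem_erase.1 (this y hy)).1

/-- If the set of finite subsets of `X` is Dedekind-finite, then a nonempty internal chain of finite
subsets of `X` has a largest element. -/
theorem FinPow.exists_greatest_of_chain (hX : DedekindFinite M (FinPow X)) {C : FinPow X → Prop}
    (hC : Internal M C) (hne : ∃ F, C F) (hch : ∀ F G, C F → C G → F ⊆ G ∨ G ⊆ F) :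
    ∃ F, C F ∧ ∀ G, C G → G ⊆ F := by
  by_contra hno
  push Not at hno
  -- The map `s` sends a member `F` of the chain to the least member not contained in `F`, and fixes
  -- every set outside the chain. A minimal such member is least because the members are comparable.
  have hs : ∀ F, ∃ G, (C F → C G ∧ ¬ G ⊆ F ∧ ∀ H, C H → ¬ H ⊆ F → G ⊆ H) ∧ (¬ C F → G = F) := by
    intro F
    by_cases hF : C F
    · obtain ⟨G, hG, hGF⟩ := hno F hF
      obtain ⟨H, hH, hm⟩ := exists_minimal (D := fun G => C G ∧ ¬ G ⊆ F) (by fun_prop) ⟨hG, hGF⟩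
      refine ⟨H, fun _ => ⟨hH.1, hH.2, fun K hK hKF => ?_⟩, fun h => (h hF).elim⟩
      rcases hch K H hK hH.1 with h | h
      · exact hm K ⟨hK, hKF⟩ h
      · exact h
    · exact ⟨F, fun h => (hF h).elim, fun _ => rfl⟩
  choose s hs hs' using hs
  have hsi : Internal M s := by
    apply Internal.of_graph
    have : ∀ F G, s F = G ↔ (C F ∧ C G ∧ ¬ G ⊆ F ∧ ∀ H, C H → ¬ H ⊆ F → G ⊆ H) ∨
        ¬ C F ∧ G = F := by
      intro F G
      constructor
      · rintro rfl
        by_cases hF : C F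
        · exact Or.inl ⟨hF, hs F hF⟩
        · exact Or.inr ⟨hF, hs' F hF⟩
      · rintro (⟨hF, hG, hGF, h⟩ | ⟨hF, rfl⟩)
        · obtain ⟨h1, h2, h3⟩ := hs F hF
          exact Subset.antisymm (h3 G hG hGF) (h _ h1 h2)
        · exact hs' _ hF
    simp only [this, forall_iff_not_exists_not, imp_iff_not_or]
    fun_prop
  have hinj : Function.Injective s := by
    -- If `F` is strictly below `G`, then `s F ⊆ G` whereas `s G` is not contained in `G`.
    have aux : ∀ F G, C F → C G → F ⊆ G → s F = s G → F = G := fun F G hF hG hFG h => by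
      by_contra hne
      have h1 : ¬ G ⊆ F := fun h => hne (Subset.antisymm hFG h)
      exact (hs G hG).2.1 (h ▸ (hs F hF).2.2 G hG h1)
    intro F G h
    by_cases hF : C F <;> by_cases hG : C G
    · rcases hch F G hF hG with hFG | hFG
      · exact aux F G hF hG hFG h
      · exact (aux G F hG hF hFG h.symm).symm
    · exact (hG (hs' G hG ▸ h ▸ (hs F hF).1)).elim
    · exact (hF (hs' F hF ▸ h ▸ (hs G hG).1)).elim
    · rwa [hs' F hF, hs' G hG] at h
  obtain ⟨F, hF⟩ := hne
  -- The smallest member `m` has no preimage: the value of `s` at a member `G` is not contained in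
  -- `G`, whereas `m` is; outside the chain `s` is the identity.
  obtain ⟨m, hm, hmin⟩ := exists_minimal hC hF
  obtain ⟨G, hG⟩ := hX hsi.toIFun (fun F G h => hinj (by simpa using h)) m
  rw [Internal.toIFun_apply] at hG
  by_cases hCG : C G
  · obtain ⟨-, h2, -⟩ := hs G hCG
    rw [hG] at h2
    rcases hch m G hm hCG with h | h
    · exact h2 h
    · exact h2 (hmin G hCG h)
  · rw [hs' G hCG] at hG
    exact hCG (hG ▸ hm)

/-- If the set of finite subsets of `X` is Dedekind-finite, then a finite subset of `X` generates a
finite subset under a monotone inflationary operation. -/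
theorem FinPow.exists_closed (hX : DedekindFinite M (FinPow X)) {Φ : FinPow X → FinPow X}
    (hΦ : Internal M Φ) (hmono : ∀ F G, F ⊆ G → Φ F ⊆ Φ G) (hinfl : ∀ F, F ⊆ Φ F)
    (F : FinPow X) : ∃ K, F ⊆ K ∧ Φ K ⊆ K := by
  -- The orbit of `F` under `Φ`, defined without recursion as the intersection of all internal
  -- families that contain `F` and are closed under `Φ`. Its largest element `K` satisfies `Φ K ⊆ K`
  -- because `Φ K` is again in the orbit.
  let C : FinPow X → Prop := fun G =>
    ∀ D : IFun M (FinPow X) Prop, D F → (∀ H, D H → D (Φ H)) → D G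
  have hC : Internal M C := by
    simp only [C, forall_iff_not_exists_not, imp_iff_not_or]
    fun_prop
  have hCF : C F := fun D h _ => h
  have hCs : ∀ G, C G → C (Φ G) := fun G hG D h h' => h' G (hG D h h')
  have hind : ∀ {P : FinPow X → Prop}, Internal M P → P F → (∀ G, C G → P G → P (Φ G)) →
      ∀ G, C G → P G := fun {P} hP h0 hs G hG => by
    have hi : Internal M (fun G => C G ∧ P G) := by fun_prop
    have := hG hi.toIFun (by simpa using ⟨hCF, h0⟩)
      (fun H hH => by
        simp only [Internal.toIFun_apply] at hH ⊢
        exact ⟨hCs H hH.1, hs H hH.1 hH.2⟩)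
    simp only [Internal.toIFun_apply] at this
    exact this.2
  have hF : ∀ G, C G → F ⊆ G :=
    hind (by fun_prop) (Subset.refl F) fun G _ h => Subset.trans h (hinfl G)
  -- Double induction over the orbit: if `G` and `H` are comparable, then so are `Φ G` and `Φ H` by
  -- monotonicity, and `F` lies below every member.
  have hch : ∀ G, C G → ∀ H, C H → G ⊆ H ∨ H ⊆ G := by
    refine hind ?_ (fun H hH => Or.inl (hF H hH)) fun G hG ih => ?_
    · simp only [forall_iff_not_exists_not, imp_iff_not_or]
      fun_prop
    · refine hind (by fun_prop) (Or.inr (hF _ (hCs G hG))) fun H hH _ => ?_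
      exact (ih H hH).imp (hmono _ _) (hmono _ _)
  obtain ⟨K, hK, h⟩ := exists_greatest_of_chain hX hC ⟨F, hCF⟩ fun G H hG hH => hch G hG H hH
  exact ⟨K, hF K hK, h _ (hCs K hK)⟩

end Chain

/-! ### Real and complex numbers -/

section Numbers

variable {M : Type u} [Membership M M] [ModelsZF M] {R : M} [Field (El R)] [LinearOrder (El R)]
  [hR : Fact (IsReals R)] {α : Type*} [Coded M α] [IsSet M α]

instance strictOrderedReals : IsStrictOrderedRing (El R) := hR.out.strictOrdered

instance internalAddReals : InternalAdd M (El R) := by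
  obtain ⟨f, hf⟩ := hR.out.add_internal
  exact ⟨f, funext fun p => hf p.1 p.2⟩

instance internalLEReals : InternalLE M (El R) := by
  obtain ⟨l, hl⟩ := hR.out.le_internal
  exact ⟨internal_of_defPred (fun z => z ∈ l) (by fun_prop) fun p => hl p.1 p.2⟩

@[fun_prop]
theorem Internal.mul {f g : α → El R} (hf : Internal M f) (hg : Internal M g) :
    Internal M (fun x => f x * g x) := by
  obtain ⟨m, hm⟩ := hR.out.mul_internal
  have h : Internal M (fun p : El R × El R => p.1 * p.2) := ⟨m, funext fun p => hm p.1 p.2⟩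
  exact h.comp (hf.prodMk hg)

@[fun_prop]
-- Only addition, multiplication and the order are given as internal; negation is recovered from
-- addition.
theorem Internal.neg {f : α → El R} (hf : Internal M f) : Internal M (fun x => - f x) := by
  apply Internal.of_graph
  simp only [neg_eq_iff_add_eq_zero]
  fun_prop

@[fun_prop]
theorem Internal.sq {f : α → El R} (hf : Internal M f) : Internal M (fun x => f x ^ 2) := by
  simp only [_root_.sq]
  fun_prop

instance isSetCplx : IsSet M (Cplx R) :=
  ⟨range M (El R × El R), fun _ => mem_range.trans
    ⟨fun ⟨p, hp⟩ => ⟨⟨p.1, p.2⟩, hp⟩, fun ⟨c, hc⟩ => ⟨(c.re, c.im), hc⟩⟩⟩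

@[fun_prop]
theorem internal_re : Internal M (fun z : Cplx R => z.re) := by
  refine internal_of_def (fun p => ∃ c, p.1 = opair p.2 c) (by fun_prop) fun x b => ?_
  exact ⟨fun ⟨c, h⟩ => (opair_inj h).1.symm, by rintro rfl; exact ⟨_, rfl⟩⟩

@[fun_prop]
theorem internal_im : Internal M (fun z : Cplx R => z.im) := by
  refine internal_of_def (fun p => ∃ c, p.1 = opair c p.2) (by fun_prop) fun x b => ?_
  exact ⟨fun ⟨c, h⟩ => (opair_inj h).2.symm, by rintro rfl; exact ⟨_, rfl⟩⟩

@[fun_prop]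
theorem Internal.re {f : α → Cplx R} (hf : Internal M f) : Internal M (fun x => (f x).re) :=
  internal_re.comp hf

@[fun_prop]
theorem Internal.im {f : α → Cplx R} (hf : Internal M f) : Internal M (fun x => (f x).im) :=
  internal_im.comp hf

theorem Internal.cplx {f : α → Cplx R} (hr : Internal M (fun x => (f x).re))
    (hi : Internal M (fun x => (f x).im)) : Internal M f := by
  apply Internal.of_graph
  have : ∀ p : α × Cplx R, f p.1 = p.2 ↔ (f p.1).re = p.2.re ∧ (f p.1).im = p.2.im :=
    fun p => QuadraticAlgebra.ext_iff
  simp only [this]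
  exact Internal.and ((hr.comp (f := fun p : α × Cplx R => p.1) (by fun_prop)).eq (by fun_prop))
    ((hi.comp (f := fun p : α × Cplx R => p.1) (by fun_prop)).eq (by fun_prop))

instance internalAddCplx : InternalAdd M (Cplx R) :=
  ⟨by apply Internal.cplx <;> simp only [QuadraticAlgebra.re_add, QuadraticAlgebra.im_add] <;>
    fun_prop⟩

@[fun_prop]
theorem Internal.cplxMul {f g : α → Cplx R} (hf : Internal M f) (hg : Internal M g) :
    Internal M (fun x => f x * g x) := by
  apply Internal.cplx <;> simp only [QuadraticAlgebra.re_mul, QuadraticAlgebra.im_mul] <;> fun_prop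

@[fun_prop]
theorem Internal.cplxNeg {f : α → Cplx R} (hf : Internal M f) : Internal M (fun x => - f x) := by
  apply Internal.cplx <;> simp only [QuadraticAlgebra.re_neg, QuadraticAlgebra.im_neg] <;> fun_prop

@[fun_prop]
theorem Internal.cplxSub {f g : α → Cplx R} (hf : Internal M f) (hg : Internal M g) :
    Internal M (fun x => f x - g x) := by
  simp only [sub_eq_add_neg]
  fun_prop

@[fun_prop]
theorem Internal.star {f : α → Cplx R} (hf : Internal M f) :
    Internal M (fun x => star (f x)) := by
  apply Internal.cplx <;> simp only [QuadraticAlgebra.re_star, QuadraticAlgebra.im_star] <;>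
    fun_prop

@[fun_prop]
theorem Internal.normSq {f : α → Cplx R} (hf : Internal M f) :
    Internal M (fun x => normSq (f x)) := by
  simp only [ZFModel.normSq]
  fun_prop

@[fun_prop]
theorem Internal.ofReal {f : α → El R} (hf : Internal M f) :
    Internal M (fun x => (QuadraticAlgebra.C (f x) : Cplx R)) := by
  apply Internal.cplx <;> simp only [QuadraticAlgebra.re_C, QuadraticAlgebra.im_C] <;> fun_prop

theorem normSq_nonneg (z : Cplx R) : 0 ≤ normSq z := add_nonneg (sq_nonneg _) (sq_nonneg _)

theorem normSq_eq_zero {z : Cplx R} : normSq z = 0 ↔ z = 0 := by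
  rw [normSq, add_eq_zero_iff_of_nonneg (sq_nonneg _) (sq_nonneg _), QuadraticAlgebra.ext_iff]
  simp

theorem normSq_zero : normSq (0 : Cplx R) = 0 := normSq_eq_zero.2 rfl

theorem mul_star_self (z : Cplx R) : z * star z = QuadraticAlgebra.C (normSq z) := by
  apply QuadraticAlgebra.ext <;>
    simp only [QuadraticAlgebra.re_mul, QuadraticAlgebra.im_mul, QuadraticAlgebra.re_star,
      QuadraticAlgebra.im_star, QuadraticAlgebra.re_C, QuadraticAlgebra.im_C, normSq] <;> ring

/-- An internal set function on the finite subsets of `A` that is bounded and grows by at least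
`c > 0` with each new point forces `A` to be finite. -/
theorem exists_finPow_of_growth {X : M} {ν : FinPow X → El R} (hν : Internal M ν)
    {A : El X → Prop} (hA : Internal M A) {r c : El R} (hc : 0 < c)
    (hr : ∀ F : FinPow X, (∀ x, x ∈ F → A x) → ν F ≤ r)
    (hgrow : ∀ (F : FinPow X) (x : El X), (∀ y, y ∈ F → A y) → A x → x ∉ F →
      ν F + c ≤ ν (insert x F)) :
    ∃ F : FinPow X, ∀ x, A x → x ∈ F := by
  by_contra! hno
  -- Let `b` be the supremum of the values of `ν` on finite subsets of `A`. Some value exceeds `b -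
  -- c`, and adding one more point of `A` would push it above `b`. Completeness is used here in
  -- place of counting.
  have hS : Internal M (fun y : El R => ∃ F : FinPow X, (∀ x, x ∈ F → A x) ∧ ν F = y) := by
    simp only [forall_iff_not_exists_not, imp_iff_not_or]
    fun_prop
  have hmem : ∀ y : El R, y.1 ∈ (Pow.mk _).1 ↔ _ := Pow.mem_mk hS
  obtain ⟨b, hb⟩ := hR.out.complete (Pow.mk _)
    ⟨ν ∅, (hmem _).2 ⟨∅, fun x hx => (FinPow.not_mem_empty x hx).elim, rfl⟩⟩
    ⟨r, fun y hy => by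
      obtain ⟨F, hF, rfl⟩ := (hmem y).1 hy
      exact hr F hF⟩
  obtain ⟨y, hy, hby, -⟩ := hb.exists_between (sub_lt_self b hc)
  obtain ⟨F, hF, rfl⟩ := (hmem y).1 hy
  obtain ⟨x, hx, hxF⟩ := hno F
  have h1 := hgrow F x hF hx hxF
  have h2 : ν (insert x F) ≤ b := hb.1 ((hmem _).2 ⟨_, fun y hy => by
    rcases FinPow.mem_insert.1 hy with rfl | hy
    · exact hx
    · exact hF y hy, rfl⟩)
  exact absurd (h1.trans h2) (not_le.2 (sub_lt_iff_lt_add.1 hby))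

end Numbers

/-! ### The Hilbert space -/

section Hilbert

variable {M : Type u} [Membership M M] [ModelsZF M] {R : M} [Field (El R)] [LinearOrder (El R)]
  [hR : Fact (IsReals R)] {α : Type*} [Coded M α] [IsSet M α] {X : M}

theorem normSqLE_iff {η : El X → Cplx R} (hη : Internal M η) {r : El R} :
    NormSqLE η r ↔ ∀ F : FinPow X, fsum F (fun x => normSq (η x)) ≤ r := by
  refine forall_congr' fun F => ?_
  simp only [hasSumOver_iff (show Internal M (fun x => normSq (η x)) by fun_prop)]
  exact exists_eq_left

instance isSetL2 : IsSet M (L2 R X) := isSet_subtype (by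
  simp only [normSqLE_iff (IFun.internal _), forall_iff_not_exists_not]
  fun_prop)

theorem L2.ext {ξ η : L2 R X} (h : ∀ x, ξ.1 x = η.1 x) : ξ = η := Subtype.ext (IFun.ext h)

theorem Internal.l2 {f : α → L2 R X} (hf : Internal M (fun p : α × El X => (f p.1).1 p.2)) :
    Internal M f := Internal.of_val (Internal.curry hf)

theorem exists_normSqLE {η : El X → Cplx R} (hη : Internal M η) {K : FinPow X}
    (hK : ∀ x, x ∉ K → η x = 0) : NormSqLE η (fsum K fun x => normSq (η x)) :=
  (normSqLE_iff hη).2 fun _ => fsum_le_of_support (by fun_prop) (fun x => normSq_nonneg _)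
    fun x hx => by rw [hK x hx, normSq_zero]

/-- A finitely supported internal function as an element of `ℓ²(X)`. -/
noncomputable def L2.mk {η : El X → Cplx R} (hη : Internal M η) {K : FinPow X}
    (hK : ∀ x, x ∉ K → η x = 0) : L2 R X :=
  ⟨hη.toIFun, _, by
    have : ⇑hη.toIFun = η := funext fun x => hη.toIFun_apply x
    rw [this]
    exact exists_normSqLE hη hK⟩

@[simp]
theorem L2.mk_apply {η : El X → Cplx R} (hη : Internal M η) {K : FinPow X}
    (hK : ∀ x, x ∉ K → η x = 0) (x : El X) : (L2.mk hη hK).1 x = η x := hη.toIFun_apply x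

variable [hX : Fact (DedekindFinite M (FinPow X))]

/-- Square-summable functions on a CF set are finitely supported. -/
theorem L2.exists_support (ξ : L2 R X) : ∃ F : FinPow X, ∀ x, x ∈ F ↔ ¬ ξ.1 x = 0 := by
  obtain ⟨r, hr⟩ := ξ.2
  rw [normSqLE_iff ξ.1.internal] at hr
  have hN : Internal M (fun x => ZFModel.normSq (ξ.1 x)) := by fun_prop
  -- A level set is finite because each of its points adds at least `ε` to sums bounded by `r`.
  have hlev : ∀ ε : El R, 0 < ε → ∃ F : FinPow X, ∀ x, x ∈ F ↔ ε ≤ normSq (ξ.1 x) := by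
    intro ε hε
    obtain ⟨F, hF⟩ := exists_finPow_of_growth (X := X)
      (ν := fun F => fsum F fun x => normSq (ξ.1 x)) (A := fun x => ε ≤ normSq (ξ.1 x))
      (by fun_prop) (by fun_prop) hε (fun F _ => hr F) fun F x _ hx hxF => by
        rw [fsum_insert hN hxF]
        exact add_le_add le_rfl hx
    refine ⟨F.sep fun x => ε ≤ normSq (ξ.1 x), fun x => ?_⟩
    rw [FinPow.mem_sep (P := fun x => ε ≤ normSq (ξ.1 x)) (by fun_prop)]
    exact and_iff_right_of_imp (hF x)
  -- Level sets are nested, so there is a largest one. It contains each point `x` of the support, as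
  -- seen from the level `ε = |ξ x|²`.
  obtain ⟨K, -, hK⟩ := FinPow.exists_greatest_of_chain hX.out
    (C := fun F => ∃ ε : El R, 0 < ε ∧ ∀ x, x ∈ F ↔ ε ≤ normSq (ξ.1 x))
    (by simp only [forall_iff_not_exists_not]; fun_prop)
    (by
      obtain ⟨F, hF⟩ := hlev 1 one_pos
      exact ⟨F, 1, one_pos, hF⟩)
    (by
      rintro F G ⟨ε, -, hF⟩ ⟨δ, -, hG⟩
      rcases le_total ε δ with h | h
      · exact Or.inr fun x hx => (hF x).2 (h.trans ((hG x).1 hx))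
      · exact Or.inl fun x hx => (hG x).2 (h.trans ((hF x).1 hx)))
  refine ⟨K.sep fun x => ¬ ξ.1 x = 0, fun x => ?_⟩
  rw [FinPow.mem_sep (P := fun x => ¬ ξ.1 x = 0) (by fun_prop)]
  refine and_iff_right_of_imp fun hx => ?_
  have hpos : 0 < normSq (ξ.1 x) :=
    lt_of_le_of_ne (normSq_nonneg _) fun h => hx (normSq_eq_zero.1 h.symm)
  obtain ⟨F, hF⟩ := hlev _ hpos
  exact hK F ⟨_, hpos, hF⟩ x ((hF x).2 le_rfl)

/-- The support of an element of `ℓ²(X)`. -/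
noncomputable def L2.supp (ξ : L2 R X) : FinPow X := ξ.exists_support.choose

theorem L2.mem_supp {ξ : L2 R X} {x : El X} : x ∈ ξ.supp ↔ ¬ ξ.1 x = 0 :=
  ξ.exists_support.choose_spec x

theorem L2.apply_eq_zero {ξ : L2 R X} {x : El X} (hx : x ∉ ξ.supp) : ξ.1 x = 0 := by
  by_contra h
  exact hx (L2.mem_supp.2 h)

@[fun_prop]
theorem Internal.supp {f : α → L2 R X} (hf : Internal M f) : Internal M (fun a => (f a).supp) := by
  apply Internal.finPow_of_mem
  simp only [L2.mem_supp]
  fun_prop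

/-- The inner product of `ℓ²(X)`. -/
noncomputable def ip (ξ η : L2 R X) : Cplx R := fsum ξ.supp fun x => ξ.1 x * star (η.1 x)

@[fun_prop]
theorem Internal.ip {f g : α → L2 R X} (hf : Internal M f) (hg : Internal M g) :
    Internal M (fun a => ip (f a) (g a)) := by
  unfold ZFModel.ip
  fun_prop

theorem fsum_eq_ip {ξ η : L2 R X} {K : FinPow X}
    (hK : ∀ x, x ∉ K → ξ.1 x * star (η.1 x) = 0) :
    fsum K (fun x => ξ.1 x * star (η.1 x)) = ip ξ η := by
  have hi : Internal M (fun x => ξ.1 x * star (η.1 x)) := by fun_prop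
  rw [ip, fsum_subset hi (fun x hx => FinPow.mem_union.2 (Or.inl hx) : K ⊆ K ∪ ξ.supp)
    fun x _ hx => hK x hx, fsum_subset hi
    (fun x hx => FinPow.mem_union.2 (Or.inr hx) : ξ.supp ⊆ K ∪ ξ.supp)
    fun x _ hx => by rw [L2.apply_eq_zero hx, zero_mul]]

theorem ip_eq_fsum_of_subset {ξ η : L2 R X} {K : FinPow X} (hK : ξ.supp ⊆ K) :
    ip ξ η = fsum K (fun x => ξ.1 x * star (η.1 x)) :=
  (fsum_eq_ip fun x hx => by rw [L2.apply_eq_zero fun h => hx (hK x h), zero_mul]).symm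

/-- The net of finite sums is constant from the support of `ξ` onwards, so its only limit is `ip ξ
η`. -/
theorem isInner_iff {ξ η : L2 R X} {c : Cplx R} : IsInner ξ η c ↔ c = ip ξ η := by
  have hi : Internal M (fun x => ξ.1 x * star (η.1 x)) := by fun_prop
  have hK : ∀ F : FinPow X, (∀ x : M, x ∈ ξ.supp.1.1 → x ∈ F.1.1) →
      fsum F (fun x => ξ.1 x * star (η.1 x)) = ip ξ η := fun F hF =>
    (ip_eq_fsum_of_subset fun x hx => hF x.1 hx).symm
  simp only [IsInner, HasSumC, hasSumOver_iff hi, exists_eq_left]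
  constructor
  · intro h
    by_contra hne
    have hpos : 0 < normSq (ip ξ η - c) := lt_of_le_of_ne (normSq_nonneg _) fun h =>
      hne (sub_eq_zero.1 (normSq_eq_zero.1 h.symm)).symm
    -- With `ε = min 1 N`, where `N` is the squared distance, `ε² ≤ ε ≤ N`; no square root is
    -- needed.
    obtain ⟨ε, hε, hε'⟩ : ∃ ε : El R, 0 < ε ∧ ε ^ 2 ≤ normSq (ip ξ η - c) := by
      refine ⟨min 1 (normSq (ip ξ η - c)), lt_min one_pos hpos, ?_⟩
      rw [sq]
      exact (mul_le_of_le_one_left (lt_min one_pos hpos).le (min_le_left _ _)).trans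
        (min_le_right _ _)
    obtain ⟨F, hF⟩ := h ε hε
    have h1 := hF (F ∪ ξ.supp) fun x hx =>
      (FinPow.mem_union (x := ⟨x, F.1.2 x hx⟩)).2 (Or.inl hx)
    rw [hK _ fun x hx => (FinPow.mem_union (x := ⟨x, ξ.supp.1.2 x hx⟩)).2 (Or.inr hx)] at h1
    exact absurd h1 (not_lt.2 hε')
  · rintro rfl ε hε
    refine ⟨ξ.supp, fun F hF => ?_⟩
    rw [hK F hF, sub_self, normSq_zero]
    positivity

theorem ip_conj (ξ η : L2 R X) : ip η ξ = star (ip ξ η) := by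
  have h : fsum η.supp (fun x => star (ξ.1 x * star (η.1 x))) = ip η ξ := by
    rw [ip]
    congr 1
    funext x
    rw [star_mul, star_star]
  rw [← h, fsum_map (φ := fun z : Cplx R => star z) (by fun_prop) (star_zero _) star_add
    (by fun_prop), fsum_eq_ip fun x hx => by rw [L2.apply_eq_zero hx, star_zero, mul_zero]]

theorem ip_lin_left {a b : Cplx R} {ξ η ζ : L2 R X} (h : ∀ x, ζ.1 x = a * ξ.1 x + b * η.1 x)
    (θ : L2 R X) : ip ζ θ = a * ip ξ θ + b * ip η θ := by
  have hl : ∀ (c : Cplx R) (ξ : L2 R X), fsum θ.supp (fun x => c * (ξ.1 x * star (θ.1 x))) =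
      c * ip ξ θ := fun c ξ => by
    rw [fsum_map (φ := fun z : Cplx R => c * z) (by fun_prop) (mul_zero _) (mul_add _)
      (by fun_prop), fsum_eq_ip fun x hx => by rw [L2.apply_eq_zero hx, star_zero, mul_zero]]
  rw [← hl, ← hl, ← fsum_add (by fun_prop) (by fun_prop),
    ← fsum_eq_ip (K := θ.supp) fun x hx => by rw [L2.apply_eq_zero hx, star_zero, mul_zero]]
  congr 1
  funext x
  rw [h x]
  ring

theorem ip_lin_right {a b : Cplx R} {ξ η ζ : L2 R X} (h : ∀ x, ζ.1 x = a * ξ.1 x + b * η.1 x)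
    (θ : L2 R X) : ip θ ζ = star a * ip θ ξ + star b * ip θ η := by
  rw [ip_conj ζ, ip_lin_left h, star_add, star_mul, star_mul, ← ip_conj, ← ip_conj]
  ring

theorem ip_self (ξ : L2 R X) :
    ip ξ ξ = QuadraticAlgebra.C (fsum ξ.supp fun x => normSq (ξ.1 x)) := by
  rw [ip, ← fsum_map (φ := fun r : El R => (QuadraticAlgebra.C r : Cplx R)) (by fun_prop) rfl
    (fun a b => QuadraticAlgebra.C_add a b) (by fun_prop)]
  congr 1
  funext x
  exact mul_star_self _

theorem ip_self_nonneg (ξ : L2 R X) : 0 ≤ (ip ξ ξ).re ∧ (ip ξ ξ).im = 0 := by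
  rw [ip_self]
  exact ⟨fsum_nonneg (by fun_prop) fun x _ => normSq_nonneg _, rfl⟩

theorem ip_self_pos {ξ : L2 R X} {x : El X} (hx : ξ.1 x ≠ 0) : 0 < (ip ξ ξ).re := by
  refine lt_of_le_of_ne (ip_self_nonneg ξ).1 fun h => hx ?_
  rw [ip_self] at h
  exact normSq_eq_zero.1 (eq_zero_of_fsum_eq_zero (f := fun x => normSq (ξ.1 x)) (by fun_prop)
    (fun x _ => normSq_nonneg _) h.symm (L2.mem_supp.2 hx))

/-- The linear combination `a ξ + b η`. -/
noncomputable def L2.lin (a : Cplx R) (ξ : L2 R X) (b : Cplx R) (η : L2 R X) : L2 R X :=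
  L2.mk (η := fun x => a * ξ.1 x + b * η.1 x) (by fun_prop) (K := ξ.supp ∪ η.supp) fun x hx => by
    rw [FinPow.mem_union, not_or] at hx
    rw [L2.apply_eq_zero hx.1, L2.apply_eq_zero hx.2, mul_zero, mul_zero, add_zero]

theorem L2.lin_apply (a : Cplx R) (ξ : L2 R X) (b : Cplx R) (η : L2 R X) (x : El X) :
    (L2.lin a ξ b η).1 x = a * ξ.1 x + b * η.1 x := L2.mk_apply _ _ x

open Classical in
/-- The vector `c e_y`. -/
noncomputable def L2.single (y : El X) (c : Cplx R) : L2 R X :=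
  L2.mk (η := fun x => if x = y then c else 0) (by fun_prop) (K := insert y ∅) fun x hx =>
    if_neg fun h => hx (FinPow.mem_insert.2 (Or.inl h))

open Classical in
theorem L2.single_apply (y : El X) (c : Cplx R) (x : El X) :
    (L2.single y c).1 x = if x = y then c else 0 := L2.mk_apply _ _ x

@[fun_prop]
theorem Internal.single {f : α → El X} {g : α → Cplx R} (hf : Internal M f) (hg : Internal M g) :
    Internal M (fun a => L2.single (f a) (g a)) := by
  classical
  apply Internal.l2
  simp only [L2.single_apply]
  fun_prop

theorem ip_single (ξ : L2 R X) (y : El X) : ip ξ (L2.single y 1) = ξ.1 y := by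
  classical
  rw [← fsum_eq_ip (K := insert y ∅) fun x hx => by
    rw [L2.single_apply, if_neg fun h => hx (FinPow.mem_insert.2 (Or.inl h)), star_zero, mul_zero]]
  rw [fsum_insert (by fun_prop) (FinPow.not_mem_empty y), fsum_empty (by fun_prop), zero_add,
    L2.single_apply, if_pos rfl, star_one, mul_one]

end Hilbert

/-! ### Bounded operators -/

section Operators

variable {M : Type u} [Membership M M] [ModelsZF M] {R : M} [Field (El R)] [LinearOrder (El R)]
  [hR : Fact (IsReals R)] {α : Type*} [Coded M α] [IsSet M α] {X : M}

instance isSetOp : IsSet M (Op R X) := isSet_subtype (by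
  simp only [IsLinearOp, IsBoundedOp, normSqLE_iff (IFun.internal _), forall_iff_not_exists_not,
    imp_iff_not_or]
  fun_prop)

theorem Op.ext {S T : Op R X} (h : ∀ ξ x, (S.1 ξ).1 x = (T.1 ξ).1 x) : S = T :=
  Subtype.ext (IFun.ext fun ξ => L2.ext (h ξ))

/-- The bounded operator given by an internal linear contraction. -/
noncomputable def Op.mk {f : L2 R X → L2 R X} (hf : Internal M f)
    (hlin : ∀ (a b : Cplx R) (ξ η ζ : L2 R X), (∀ x, ζ.1 x = a * ξ.1 x + b * η.1 x) →
      ∀ x, (f ζ).1 x = a * (f ξ).1 x + b * (f η).1 x)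
    (hbd : ∀ (ξ : L2 R X) (F : FinPow X), ∃ G : FinPow X,
      fsum F (fun x => normSq ((f ξ).1 x)) ≤ fsum G (fun x => normSq (ξ.1 x))) : Op R X :=
  ⟨hf.toIFun, by
    intro a b ξ η ζ h
    simpa only [Internal.toIFun_apply] using hlin a b ξ η ζ h, 1, by
    intro ξ r hr
    rw [normSqLE_iff (IFun.internal _)] at hr
    rw [Internal.toIFun_apply, one_mul, normSqLE_iff (IFun.internal _)]
    intro F
    obtain ⟨G, hG⟩ := hbd ξ F
    exact hG.trans (hr G)⟩

@[simp]
theorem Op.mk_apply {f : L2 R X → L2 R X} (hf : Internal M f) (hlin) (hbd) (ξ : L2 R X) :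
    (Op.mk hf hlin hbd).1 ξ = f ξ := hf.toIFun_apply ξ

theorem Internal.op {f : α → Op R X}
    (hf : Internal M (fun p : (α × L2 R X) × El X => ((f p.1.1).1 p.1.2).1 p.2)) :
    Internal M f := Internal.of_val (Internal.curry (Internal.l2 hf))

variable [hX : Fact (DedekindFinite M (FinPow X))]

theorem isAdjoint_iff {T U : Op R X} :
    IsAdjoint T U ↔ ∀ ξ η, ip (T.1 ξ) η = ip ξ (U.1 η) := by
  simp only [IsAdjoint, isInner_iff]
  exact ⟨fun h ξ η => (h ξ η _).1 rfl, fun h ξ η c => by rw [h]⟩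

theorem Op.lin_apply (T : Op R X) (a b : Cplx R) (ξ η : L2 R X) (x : El X) :
    (T.1 (L2.lin a ξ b η)).1 x = a * (T.1 ξ).1 x + b * (T.1 η).1 x :=
  T.2.1 a b ξ η _ (L2.lin_apply a ξ b η) x

/-- The projection onto the functions supported on `A`. -/
noncomputable def Op.proj (A : Pow X) : Op R X :=
  open Classical in
  Op.mk (f := fun ξ => L2.mk (η := fun x => if x ∈ A then ξ.1 x else 0) (by fun_prop)
      (K := ξ.supp) fun x hx => by rw [L2.apply_eq_zero hx, ite_self])
    (Internal.l2 (by
      simp only [L2.mk_apply]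
      fun_prop))
    (fun a b ξ η ζ h x => by
      simp only [L2.mk_apply, h x]
      split_ifs <;> simp)
    (fun ξ F => ⟨F, by
      simp only [L2.mk_apply]
      refine fsum_le_fsum (by fun_prop) (by fun_prop) fun x _ => ?_
      split_ifs
      · exact le_rfl
      · rw [normSq_zero]
        exact normSq_nonneg _⟩)

open Classical in
theorem Op.proj_apply (A : Pow X) (ξ : L2 R X) (x : El X) :
    ((Op.proj A).1 ξ).1 x = if x ∈ A then ξ.1 x else 0 := by
  rw [Op.proj, Op.mk_apply, L2.mk_apply]

theorem internal_proj : Internal M (Op.proj : Pow X → Op R X) := by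
  classical
  apply Internal.op
  simp only [Op.proj_apply]
  fun_prop

/-- The matrix unit that sends `e_y` to `e_x`. -/
noncomputable def Op.matrixUnit (x y : El X) : Op R X :=
  Op.mk (f := fun ξ => L2.single x (ξ.1 y)) (by fun_prop)
    (fun a b ξ η ζ h z => by
      classical
      simp only [L2.single_apply, h y]
      split_ifs <;> simp)
    (fun ξ F => ⟨insert y ∅, by
      classical
      have h := fsum_le_of_support (F := F) (G := insert x ∅)
        (show Internal M (fun z => normSq ((L2.single x (ξ.1 y)).1 z)) by fun_prop)
        (fun z => normSq_nonneg _) (fun z hz => by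
          rw [L2.single_apply, if_neg fun h => hz (FinPow.mem_insert.2 (Or.inl h)), normSq_zero])
      rwa [fsum_insert (by fun_prop) (FinPow.not_mem_empty x), fsum_empty (by fun_prop), zero_add,
        L2.single_apply, if_pos rfl, ← zero_add (normSq (ξ.1 y)),
        ← fsum_empty (show Internal M (fun z => normSq (ξ.1 z)) by fun_prop),
        ← fsum_insert (f := fun z => normSq (ξ.1 z)) (by fun_prop) (FinPow.not_mem_empty y)] at h⟩)

theorem Op.matrixUnit_apply (x y : El X) (ξ : L2 R X) :
    (Op.matrixUnit x y).1 ξ = L2.single x (ξ.1 y) := by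
  rw [Op.matrixUnit, Op.mk_apply]

theorem isProd_matrixUnit (x y z : El X) :
    IsProd (Op.matrixUnit x y : Op R X) (Op.matrixUnit y z) (Op.matrixUnit x z) := by
  classical
  intro ξ
  rw [Op.matrixUnit_apply, Op.matrixUnit_apply, Op.matrixUnit_apply, L2.single_apply, if_pos rfl]

theorem exists_isOne : ∃ I : Op R X, IsOne I := by
  classical
  refine ⟨Op.proj ⟨X, fun _ h => h⟩, fun ξ => L2.ext fun x => ?_⟩
  rw [Op.proj_apply]
  exact if_pos x.2

/-! ### Vector states -/

/-- The state is `T ↦ ⟨T ξ, ξ⟩ / ⟨ξ, ξ⟩` and `c = ⟨ξ, ξ⟩`. Normalizing the functional instead of the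
vector avoids square roots. Positivity is `⟨T* T ξ, ξ⟩ = ⟨T ξ, T ξ⟩`. -/
theorem exists_vectorState {ξ : L2 R X} {x : El X} (hx : ξ.1 x ≠ 0) :
    ∃ (φ : IFun M (Op R X) (Cplx R)) (c : Cplx R), IsState φ ∧
      ∀ T : Op R X, ip (T.1 ξ) ξ = c * φ T := by
  have hpos := ip_self_pos hx
  have hself : ip ξ ξ = QuadraticAlgebra.C (ip ξ ξ).re :=
    QuadraticAlgebra.ext rfl (ip_self_nonneg ξ).2
  generalize (ip ξ ξ).re = r at hpos hself
  have hrr : (QuadraticAlgebra.C r : Cplx R) * QuadraticAlgebra.C r⁻¹ = 1 := by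
    rw [← QuadraticAlgebra.C_mul, mul_inv_cancel₀ hpos.ne', QuadraticAlgebra.C_one]
  have hφ : Internal M (fun T : Op R X => QuadraticAlgebra.C r⁻¹ * ip (T.1 ξ) ξ) := by fun_prop
  refine ⟨hφ.toIFun, QuadraticAlgebra.C r, ⟨?_, ?_, ?_⟩, fun T => ?_⟩
  · intro a b S T U h
    simp only [Internal.toIFun_apply]
    rw [ip_lin_left (h ξ)]
    ring
  · intro T S P hTS hP
    have h : ip (P.1 ξ) ξ = ip (T.1 ξ) (T.1 ξ) := by
      rw [hP ξ, ip_conj, ← isAdjoint_iff.1 hTS, ← ip_conj]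
    obtain ⟨h1, h2⟩ := ip_self_nonneg (T.1 ξ)
    simp only [Internal.toIFun_apply, h, QuadraticAlgebra.re_mul, QuadraticAlgebra.im_mul,
      QuadraticAlgebra.re_C, QuadraticAlgebra.im_C, h2]
    refine ⟨?_, by ring⟩
    have := mul_nonneg (inv_nonneg.2 hpos.le) h1
    linarith
  · obtain ⟨I, hI⟩ := exists_isOne (R := R) (X := X)
    refine ⟨I, hI, ?_⟩
    rw [Internal.toIFun_apply, hI ξ, hself, mul_comm, hrr]
  · rw [Internal.toIFun_apply, ← mul_assoc, hrr, one_mul]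

/-- Polarization: the quadratic forms are compared at `ξ + a η`, and the mixed terms are isolated by
the values `a = 1` and `a = i`. Taking `η = e_y` reads off the coordinate at `y`. -/
theorem eq_of_ip_eq {S T : Op R X} (h : ∀ ξ, ip (S.1 ξ) ξ = ip (T.1 ξ) ξ) : S = T := by
  have key : ∀ (a : Cplx R) (ξ η : L2 R X),
      star a * (ip (S.1 ξ) η - ip (T.1 ξ) η) + a * (ip (S.1 η) ξ - ip (T.1 η) ξ) = 0 := by
    intro a ξ η
    have exp : ∀ U : Op R X, ip (U.1 (L2.lin 1 ξ a η)) (L2.lin 1 ξ a η) =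
        ip (U.1 ξ) ξ + star a * ip (U.1 ξ) η + a * ip (U.1 η) ξ +
          a * star a * ip (U.1 η) η := fun U => by
      rw [ip_lin_left (U.lin_apply 1 a ξ η), ip_lin_right (L2.lin_apply 1 ξ a η),
        ip_lin_right (L2.lin_apply 1 ξ a η), star_one]
      ring
    have h1 := h (L2.lin 1 ξ a η)
    rw [exp, exp, h ξ, h η] at h1
    linear_combination h1
  refine Op.ext fun ξ y => ?_
  have h1 := key 1 ξ (L2.single y 1)
  have h2 := key ⟨0, 1⟩ ξ (L2.single y 1)
  rw [ip_single, ip_single] at h1 h2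
  generalize (S.1 ξ).1 y = s at h1 h2 ⊢
  generalize (T.1 ξ).1 y = t at h1 h2 ⊢
  generalize ip (S.1 (L2.single y 1)) ξ - ip (T.1 (L2.single y 1)) ξ = b at h1 h2
  have h3 := congrArg QuadraticAlgebra.re h1
  have h4 := congrArg QuadraticAlgebra.im h1
  have h5 := congrArg QuadraticAlgebra.re h2
  have h6 := congrArg QuadraticAlgebra.im h2
  simp only [star_one, one_mul, QuadraticAlgebra.re_add, QuadraticAlgebra.im_add,
    QuadraticAlgebra.re_sub, QuadraticAlgebra.im_sub, QuadraticAlgebra.re_mul,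
    QuadraticAlgebra.im_mul, QuadraticAlgebra.re_star, QuadraticAlgebra.im_star,
    QuadraticAlgebra.re_zero, QuadraticAlgebra.im_zero] at h3 h4 h5 h6
  apply QuadraticAlgebra.ext <;> linarith

theorem exists_isState_ne {S T : Op R X} (hST : S ≠ T) :
    ∃ φ : IFun M (Op R X) (Cplx R), IsState φ ∧ φ S ≠ φ T := by
  by_contra! hno
  refine hST (eq_of_ip_eq fun ξ => ?_)
  by_cases hξ : ∃ x, ξ.1 x ≠ 0
  · obtain ⟨x, hx⟩ := hξ
    obtain ⟨φ, c, hφ, h⟩ := exists_vectorState hx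
    rw [h, h, hno φ hφ]
  · push Not at hξ
    have h0 : ∀ θ, ip θ ξ = 0 := fun θ => fsum_eq_zero (by fun_prop) fun x _ => by
      rw [hξ x, star_zero, mul_zero]
    rw [h0, h0]

/-! ### Traces -/

theorem isAdjoint_proj (A : Pow X) : IsAdjoint (Op.proj A : Op R X) (Op.proj A) := by
  classical
  refine isAdjoint_iff.2 fun ξ η => ?_
  rw [← fsum_eq_ip (K := ξ.supp) fun x hx => by
    rw [Op.proj_apply, L2.apply_eq_zero hx, ite_self, zero_mul], ip]
  congr 1
  funext x
  rw [Op.proj_apply, Op.proj_apply]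
  split_ifs <;> simp

theorem isProd_proj (A : Pow X) : IsProd (Op.proj A : Op R X) (Op.proj A) (Op.proj A) := by
  classical
  refine fun ξ => L2.ext fun x => ?_
  simp only [Op.proj_apply]
  split_ifs <;> rfl

theorem isLinComb_proj {A B C : Pow X} (h : ∀ x : El X, x ∈ A → x ∉ B)
    (hC : ∀ x : El X, x ∈ C ↔ x ∈ A ∨ x ∈ B) :
    IsLinComb 1 (Op.proj A : Op R X) 1 (Op.proj B) (Op.proj C) := by
  classical
  intro ξ x
  have := h x
  simp only [Op.proj_apply, hC]
  by_cases hA : x ∈ A <;> by_cases hB : x ∈ B <;> simp_all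

theorem proj_eq_matrixUnit {A : Pow X} {a : El X} (h : ∀ x : El X, x ∈ A ↔ x = a) :
    (Op.proj A : Op R X) = Op.matrixUnit a a := by
  classical
  refine Op.ext fun ξ x => ?_
  rw [Op.proj_apply, Op.matrixUnit_apply, L2.single_apply]
  simp only [h]
  split_ifs with hx
  · rw [hx]
  · rfl

/-- A tracial state induces a finitely additive probability measure that vanishes on singletons. -/
theorem IsTracialState.exists_isFinAddProb (hfin : ¬ IsFin X) {τ : IFun M (Op R X) (Cplx R)}
    (hτ : IsTracialState τ) :
    ∃ μ : IFun M (Pow X) (El R), IsFinAddProb μ ∧ VanishesOnSingletons μ := by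
  obtain ⟨hst, htr⟩ := hτ
  have hp := internal_proj (R := R) (X := X)
  have hμ : Internal M (fun A : Pow X => (τ (Op.proj A)).re) := by fun_prop
  have hnn : ∀ A : Pow X, 0 ≤ (τ (Op.proj A)).re := fun A =>
    (hst.positive _ _ _ (isAdjoint_proj A) (isProd_proj A)).1
  have hadd : ∀ A B C : Pow X, (∀ x : El X, x ∈ A → x ∉ B) →
      (∀ x : El X, x ∈ C ↔ x ∈ A ∨ x ∈ B) →
      (τ (Op.proj C)).re = (τ (Op.proj A)).re + (τ (Op.proj B)).re := fun A B C h hC => by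
    rw [hst.linear _ _ _ _ _ (isLinComb_proj h hC), one_mul, one_mul, QuadraticAlgebra.re_add]
  have htop : (τ (Op.proj (⟨X, fun _ h => h⟩ : Pow X))).re = 1 := by
    classical
    obtain ⟨I, hI, h1⟩ := hst.unital
    have : (Op.proj (⟨X, fun _ h => h⟩ : Pow X) : Op R X) = I := Op.ext fun ξ x => by
      rw [Op.proj_apply, hI ξ]
      exact if_pos x.2
    rw [this, h1]
    rfl
  -- With matrix units, `E_xy E_yx = E_xx` and `E_yx E_xy = E_yy`, so the trace property makes all
  -- singletons equally heavy.
  have hconst : ∀ x y : El X, τ (Op.matrixUnit x x) = τ (Op.matrixUnit y y) := fun x y =>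
    htr _ _ _ _ (isProd_matrixUnit x y x) (isProd_matrixUnit y x y)
  refine ⟨hμ.toIFun, ⟨fun A => ?_, fun A B C h hC => ?_, fun A hA => ?_⟩, fun A a hA => ?_⟩
  · simpa using hnn A
  · simpa using hadd A B C (fun x => h x.1) fun x => hC x.1
  · obtain rfl : A = ⟨X, fun _ h => h⟩ := Subtype.ext hA
    simpa using htop
  · rw [Internal.toIFun_apply]
    by_contra hne
    have haX : a ∈ X := A.2 a ((hA a).2 rfl)
    have hsing : ∀ x : El X, x ∈ A ↔ x = ⟨a, haX⟩ := fun x => by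
      rw [Subtype.ext_iff]
      exact hA x.1
    have hc : 0 < (τ (Op.proj A)).re := lt_of_le_of_ne (hnn A) (Ne.symm hne)
    rw [proj_eq_matrixUnit hsing] at hc
    -- If singletons had positive mass, the mass of a finite set would grow by that amount with each
    -- point while staying at most `1`, which forces `X` to be finite. The bound `1` comes from
    -- splitting `X` into `F` and its complement.
    obtain ⟨F, hF⟩ := exists_finPow_of_growth (X := X)
      (ν := fun F => (τ (Op.proj F.1)).re) (A := fun _ => True) (by fun_prop) (by fun_prop) hc
      (r := 1) (fun F _ => by
        have hB : Internal M (fun x : El X => x ∉ F) := by fun_prop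
        refine le_of_le_of_eq ?_ htop
        rw [hadd F.1 (Pow.mk _) ⟨X, fun _ h => h⟩ (fun x hx h => (Pow.mem_mk hB x).1 h hx) fun x =>
          ⟨fun _ => (em _).imp_right (Pow.mem_mk hB x).2, fun _ => x.2⟩]
        exact le_add_of_nonneg_right (hnn _))
      (fun F x _ _ hx => by
        obtain ⟨B, hB⟩ := Pow.exists_mk (M := M) (P := fun y : El X => y = x) (by fun_prop)
        rw [hadd F.1 B (insert x F).1 (fun y hy h => hx ((hB y).1 h ▸ hy)) fun y =>
          FinPow.mem_insert.trans (or_comm.trans (or_congr Iff.rfl (hB y).symm)),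
          proj_eq_matrixUnit hB, hconst x ⟨a, haX⟩])
    refine hfin ?_
    have : F.1.1 = X := ModelsZF.extensionality _ _ fun x =>
      ⟨F.1.2 x, fun hx => hF ⟨x, hx⟩ trivial⟩
    exact this ▸ F.2

end Operators

/-! ### Finite matrices -/

section DoubleSum

variable {M : Type u} [Membership M M] [ModelsZF M] {X Y : M} {α : Type*} [Coded M α] [IsSet M α]
  {A B : Type*} [Coded M A] [Coded M B] [IsSet M A] [IsSet M B]
  [AddCommMonoid A] [InternalAdd M A] [AddCommMonoid B] [InternalAdd M B]

/-- The sum over the product of two finite sets. -/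
noncomputable def dsum (F : FinPow Y) (K : FinPow X) (f : El Y × El X → A) : A :=
  fsum F fun k => fsum K fun z => f (k, z)

variable {F : FinPow Y} {K : FinPow X}

@[fun_prop]
theorem Internal.dsum {f : α → El Y × El X → A}
    (hf : Internal M (fun p : α × (El Y × El X) => f p.1 p.2)) :
    Internal M (fun a => dsum F K (f a)) := by
  unfold ZFModel.dsum
  have h : Internal M (fun q : (α × El Y) × El X => f q.1.1 (q.1.2, q.2)) :=
    hf.comp (f := fun q : (α × El Y) × El X => (q.1.1, (q.1.2, q.2))) (by fun_prop)
  exact Internal.fsum (by fun_prop) (Internal.fsum (by fun_prop) h)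

theorem dsum_congr {f g : El Y × El X → A} (hf : Internal M f) (hg : Internal M g)
    (h : ∀ k z, k ∈ F → z ∈ K → f (k, z) = g (k, z)) : dsum F K f = dsum F K g :=
  fsum_congr (by fun_prop) (by fun_prop) fun k hk =>
    fsum_congr (by fun_prop) (by fun_prop) fun z hz => h k z hk hz

theorem dsum_map {φ : A → B} (hφ : Internal M φ) (h0 : φ 0 = 0)
    (hadd : ∀ a b, φ (a + b) = φ a + φ b) {f : El Y × El X → A} (hf : Internal M f) :
    dsum F K (fun x => φ (f x)) = φ (dsum F K f) := by
  rw [dsum, dsum, ← fsum_map hφ h0 hadd (by fun_prop)]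
  refine fsum_congr (by fun_prop) (by fun_prop) fun k _ => ?_
  exact fsum_map hφ h0 hadd (f := fun z => f (k, z)) (by fun_prop) K

theorem dsum_add {f g : El Y × El X → A} (hf : Internal M f) (hg : Internal M g) :
    dsum F K (fun x => f x + g x) = dsum F K f + dsum F K g := by
  rw [dsum, dsum, dsum, ← fsum_add (by fun_prop) (by fun_prop)]
  refine fsum_congr (by fun_prop) (by fun_prop) fun k _ => ?_
  exact fsum_add (f := fun z => f (k, z)) (g := fun z => g (k, z)) (by fun_prop) (by fun_prop) K

theorem fsum_dsum_comm {a : M} {G : FinPow a}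
    {f : El a → El Y × El X → A} (hf : Internal M (fun p : El a × (El Y × El X) => f p.1 p.2)) :
    fsum G (fun x => dsum F K (f x)) = dsum F K (fun y => fsum G fun x => f x y) := by
  have h : Internal M (fun p : El a × El Y => fsum K fun z => f p.1 (p.2, z)) :=
    Internal.fsum (by fun_prop) (hf.comp
      (f := fun q : (El a × El Y) × El X => (q.1.1, (q.1.2, q.2))) (by fun_prop))
  unfold dsum
  rw [fsum_comm h]
  congr 1
  funext k
  exact fsum_comm (f := fun x z => f x (k, z)) (hf.comp
    (f := fun q : El a × El X => (q.1, (k, q.2))) (by fun_prop)) G K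

theorem dsum_comm {Y' X' : M} {F' : FinPow Y'} {K' : FinPow X'}
    {f : El Y × El X → El Y' × El X' → A}
    (hf : Internal M (fun p : (El Y × El X) × (El Y' × El X') => f p.1 p.2)) :
    dsum F K (fun x => dsum F' K' (f x)) = dsum F' K' (fun y => dsum F K fun x => f x y) := by
  have h1 : ∀ k, fsum K (fun z => dsum F' K' (f (k, z))) =
      dsum F' K' (fun y => fsum K fun z => f (k, z) y) := fun k =>
    fsum_dsum_comm (f := fun z y => f (k, z) y) (hf.comp
      (f := fun q : El X × (El Y' × El X') => ((k, q.1), q.2)) (by fun_prop))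
  conv_lhs => rw [dsum]
  simp only [h1]
  refine (fsum_dsum_comm (f := fun k y => fsum K fun z => f (k, z) y) ?_).trans rfl
  exact Internal.fsum (by fun_prop) (hf.comp
    (f := fun q : (El Y × (El Y' × El X')) × El X => ((q.1.1, q.2), q.1.2)) (by fun_prop))

theorem dsum_eq_single {f : El Y × El X → A} (hf : Internal M f) {k : El Y} {z : El X}
    (hk : k ∈ F) (hz : z ∈ K) (h : ∀ p, p ≠ (k, z) → f p = 0) : dsum F K f = f (k, z) := by
  rw [dsum, fsum_eq_single (by fun_prop) hk, fsum_eq_single (by fun_prop) hz]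
  · exact fun y _ hy => h _ fun he => hy (Prod.ext_iff.1 he).2
  · exact fun y _ hy => fsum_eq_zero (by fun_prop) fun x _ => h _ fun he =>
      hy (Prod.ext_iff.1 he).1

theorem eq_zero_of_dsum_eq_zero [PartialOrder A] [IsOrderedAddMonoid A] [InternalLE M A]
    {f : El Y × El X → A} (hf : Internal M f) (hnn : ∀ p, 0 ≤ f p) (h : dsum F K f = 0)
    {k : El Y} {z : El X} (hk : k ∈ F) (hz : z ∈ K) : f (k, z) = 0 := by
  have h1 := eq_zero_of_fsum_eq_zero (f := fun k => fsum K fun z => f (k, z)) (by fun_prop)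
    (fun k _ => fsum_nonneg (by fun_prop) fun z _ => hnn _) h hk
  exact eq_zero_of_fsum_eq_zero (f := fun z => f (k, z)) (by fun_prop) (fun z _ => hnn _) h1 hz

end DoubleSum

/-! ### Finite square matrices with complex entries -/

section Matrix

variable {M : Type u} [Membership M M] [ModelsZF M] {R : M} [Field (El R)] [LinearOrder (El R)]
  [hR : Fact (IsReals R)] {X Y : M} {F : FinPow Y} {K : FinPow X}

theorem dsum_mul_left {f : El Y × El X → Cplx R} (hf : Internal M f) (c : Cplx R) :
    dsum F K (fun x => c * f x) = c * dsum F K f :=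
  dsum_map (φ := fun z => c * z) (by fun_prop) (mul_zero _) (mul_add _) hf

theorem dsum_star {f : El Y × El X → Cplx R} (hf : Internal M f) :
    dsum F K (fun x => star (f x)) = star (dsum F K f) :=
  dsum_map (φ := fun z => star z) (by fun_prop) (star_zero _) star_add hf

theorem dsum_neg {f : El Y × El X → Cplx R} (hf : Internal M f) :
    dsum F K (fun x => - f x) = - dsum F K f :=
  dsum_map (φ := fun z => - z) (by fun_prop) neg_zero (fun a b => neg_add a b) hf

open Classical in
/-- An isometric square matrix of finite size in the model is unitary. -/
theorem dsum_mul_star_of_isometry {V : IFun M ((El Y × El X) × (El Y × El X)) (Cplx R)}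
    (h : ∀ b c : El Y × El X, b.1 ∈ F → b.2 ∈ K → c.1 ∈ F → c.2 ∈ K →
      dsum F K (fun a => star (V (a, b)) * V (a, c)) = if b = c then 1 else 0)
    (a b : El Y × El X) (ha : a.1 ∈ F) (ha' : a.2 ∈ K) (hb : b.1 ∈ F) (hb' : b.2 ∈ K) :
    dsum F K (fun c => V (a, c) * star (V (b, c))) = if a = b then 1 else 0 := by
  -- `Q` is the matrix `V V*`, to be shown equal to `1` on `F × K`.
  obtain ⟨Q, hQ⟩ : ∃ Q : IFun M ((El Y × El X) × (El Y × El X)) (Cplx R), ∀ a b,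
      Q (a, b) = dsum F K fun c => V (a, c) * star (V (b, c)) := by
    have hi : Internal M (fun p : (El Y × El X) × (El Y × El X) =>
      dsum F K fun c => V (p.1, c) * star (V (p.2, c))) := by fun_prop
    exact ⟨hi.toIFun, fun a b => hi.toIFun_apply (a, b)⟩
  have hQstar : ∀ a b, star (Q (a, b)) = dsum F K fun d => star (V (a, d)) * V (b, d) := by
    intro a b
    rw [hQ, ← dsum_star (by fun_prop)]
    congr 1
    funext d
    rw [star_mul, star_star, mul_comm]
  -- This is `Q V = V`, entrywise and conjugated; it follows from `Q V = V (V* V)`.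
  have hrow : ∀ a c : El Y × El X, c.1 ∈ F → c.2 ∈ K →
      dsum F K (fun b => star (V (b, c)) * star (Q (a, b))) = star (V (a, c)) := by
    intro a c hc hc'
    have h1 : ∀ b, star (V (b, c)) * star (Q (a, b)) =
        dsum F K fun d => star (V (a, d)) * (star (V (b, c)) * V (b, d)) := by
      intro b
      rw [hQstar, ← dsum_mul_left (by fun_prop)]
      congr 1
      funext d
      ring
    simp only [h1]
    rw [dsum_comm (by fun_prop)]
    have h2 : ∀ d, dsum F K (fun b => star (V (a, d)) * (star (V (b, c)) * V (b, d))) =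
        star (V (a, d)) * dsum F K (fun b => star (V (b, c)) * V (b, d)) := fun d =>
      dsum_mul_left (by fun_prop) _
    simp only [h2]
    rw [dsum_congr (g := fun d => star (V (a, d)) * if c = d then 1 else 0) (by fun_prop)
      (by fun_prop) fun k z hk hz => by rw [h c (k, z) hc hc' hk hz],
      dsum_eq_single (by fun_prop) hc hc' fun p hp => by rw [if_neg (Ne.symm hp), mul_zero],
      if_pos rfl, mul_one]
  -- The diagonal of `Q Q* = Q V V* = V V* = Q`.
  have hQQ : ∀ a, dsum F K (fun b => Q (a, b) * star (Q (a, b))) = Q (a, a) := by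
    intro a
    have h1 : ∀ b, Q (a, b) * star (Q (a, b)) =
        dsum F K fun c => V (a, c) * (star (V (b, c)) * star (Q (a, b))) := by
      intro b
      conv_lhs => rw [mul_comm, hQ a b, ← dsum_mul_left (by fun_prop)]
      congr 1
      funext c
      rw [← hQ a b]
      ring
    simp only [h1]
    rw [dsum_comm (by fun_prop), hQ a a]
    refine dsum_congr (by fun_prop) (by fun_prop) fun k z hk hz => ?_
    rw [dsum_mul_left (by fun_prop), hrow a (k, z) hk hz]
  -- Row `a` of `Q - 1` has square sum `Q_aa + (1 - conj Q_aa - Q_aa)`.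
  have hD : ∀ a : El Y × El X, a.1 ∈ F → a.2 ∈ K →
      (QuadraticAlgebra.C (dsum F K fun b => normSq (Q (a, b) - if a = b then 1 else 0)) : Cplx R) =
        1 - star (Q (a, a)) := by
    intro a ha ha'
    rw [← dsum_map (φ := fun r : El R => (QuadraticAlgebra.C r : Cplx R)) (by fun_prop) rfl
      (fun a b => QuadraticAlgebra.C_add a b) (by fun_prop)]
    have h1 : ∀ b, (QuadraticAlgebra.C (normSq (Q (a, b) - if a = b then 1 else 0)) : Cplx R) =
        Q (a, b) * star (Q (a, b)) +
          (if a = b then 1 else 0) * (1 - star (Q (a, b)) - Q (a, b)) := by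
      intro b
      rw [← mul_star_self]
      split_ifs <;> simp only [star_sub, star_one, star_zero] <;> ring
    simp only [h1]
    rw [dsum_add (by fun_prop) (by fun_prop), hQQ, dsum_eq_single (by fun_prop) ha ha' fun p hp => by
      rw [if_neg (Ne.symm hp), zero_mul], if_pos rfl]
    ring
  -- `tr (V V*) = tr (V* V) = tr 1` by exchanging the two sums. Hence the square sums of the rows of
  -- `Q - 1` add up to `0`, and every entry vanishes by positivity.
  have htr : dsum F K (fun a => Q (a, a)) = dsum F K fun _ => (1 : Cplx R) := by
    simp only [hQ]
    rw [dsum_comm (f := fun a c => V (a, c) * star (V (a, c))) (by fun_prop)]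
    refine dsum_congr (by fun_prop) (by fun_prop) fun k z hk hz => ?_
    simp only [mul_comm (V _)]
    rw [h _ _ hk hz hk hz, if_pos rfl]
  have hsum : dsum F K (fun a => dsum F K fun b =>
      normSq (Q (a, b) - if a = b then 1 else 0)) = 0 := by
    apply QuadraticAlgebra.C_injective (a := (-1 : El R)) (b := 0)
    rw [← dsum_map (φ := fun r : El R => (QuadraticAlgebra.C r : Cplx R)) (by fun_prop) rfl
      (fun a b => QuadraticAlgebra.C_add a b) (by fun_prop),
      dsum_congr (g := fun a => 1 + - star (Q (a, a))) (by fun_prop) (by fun_prop)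
      fun k z hk hz => by rw [hD _ hk hz, sub_eq_add_neg],
      dsum_add (by fun_prop) (by fun_prop), dsum_neg (by fun_prop), dsum_star (by fun_prop), htr,
      ← dsum_star (by fun_prop)]
    simp only [star_one, add_neg_cancel]
    rfl
  have h1 := eq_zero_of_dsum_eq_zero (by fun_prop) (fun p => ?_) hsum ha ha'
  · have h2 := eq_zero_of_dsum_eq_zero (by fun_prop) (fun p => normSq_nonneg _) h1 hb hb'
    rw [← hQ]
    exact sub_eq_zero.1 (normSq_eq_zero.1 h2)
  · exact fsum_nonneg (by fun_prop) fun k _ => fsum_nonneg (by fun_prop) fun z _ => normSq_nonneg _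

end Matrix

/-! ### Stable finiteness -/

section Finiteness

variable {M : Type u} [Membership M M] [ModelsZF M] {X : M}

/-- A finite subset of `X` generates a finite subset under a locally finite relation. -/
theorem FinPow.exists_closed_rel (hX : DedekindFinite M (FinPow X)) {E : El X → El X → Prop}
    (hE : Internal M (fun p : El X × El X => E p.1 p.2))
    (hfin : ∀ y, ∃ G : FinPow X, ∀ x, E y x → x ∈ G) (F : FinPow X) :
    ∃ K, F ⊆ K ∧ ∀ y, y ∈ K → ∀ x, E y x → x ∈ K := by
  have hE' : ∀ F : FinPow X, Internal M (fun x => x ∈ F ∨ ∃ y, y ∈ F ∧ E y x) := fun F => by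
    have : Internal M (fun p : El X × El X => E p.2 p.1) :=
      hE.comp (f := fun p : El X × El X => (p.2, p.1)) (by fun_prop)
    fun_prop
  -- One closure step adjoins all points related to a point of `F`. It is monotone and inflationary,
  -- and its value is determined by `F`, so the chosen `Φ` is internal.
  have hΦ : ∀ F : FinPow X, ∃ G : FinPow X, ∀ x, x ∈ G ↔ x ∈ F ∨ ∃ y, y ∈ F ∧ E y x := by
    intro F
    obtain ⟨G, hG⟩ := F.exists_biUnion hE fun y _ => hfin y
    obtain ⟨H, hH⟩ := (F ∪ G).exists_sep (hE' F)
    refine ⟨H, fun x => (hH x).trans (and_iff_right_of_imp ?_)⟩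
    rintro (hx | ⟨y, hy, hyx⟩)
    · exact FinPow.mem_union.2 (Or.inl hx)
    · exact FinPow.mem_union.2 (Or.inr (hG y hy x hyx))
  choose Φ hΦ using hΦ
  have hi : Internal M Φ := by
    apply Internal.finPow_of_mem
    simp only [hΦ]
    have : Internal M (fun p : (FinPow X × El X) × El X => E p.2 p.1.2) :=
      hE.comp (f := fun p : (FinPow X × El X) × El X => (p.2, p.1.2)) (by fun_prop)
    fun_prop
  obtain ⟨K, hFK, hK⟩ := FinPow.exists_closed hX hi
    (fun F G h x hx => (hΦ G x).2 (((hΦ F x).1 hx).imp (h x) fun ⟨y, hy, hyx⟩ => ⟨y, h y hy, hyx⟩))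
    (fun F x hx => (hΦ F x).2 (Or.inl hx)) F
  exact ⟨K, hFK, fun y hy x hyx => hK x ((hΦ K x).2 (Or.inr ⟨y, hy, hyx⟩))⟩

variable {R : M} [Field (El R)] [LinearOrder (El R)] [hR : Fact (IsReals R)]
  [hX : Fact (DedekindFinite M (FinPow X))]

theorem Op.apply_eq_zero (T : Op R X) {ξ : L2 R X} (h : ∀ x, ξ.1 x = 0) (x : El X) :
    (T.1 ξ).1 x = 0 := by
  rw [T.2.1 0 0 ξ ξ ξ (fun x => by rw [h x, zero_mul, add_zero]) x, zero_mul, add_zero]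

/-- Finite support makes linearity alone sufficient for the matrix expansion; no continuity enters.
-/
theorem Op.apply_eq_fsum (T : Op R X) (x : El X) {K : FinPow X} {ξ : L2 R X}
    (hξ : ∀ y, y ∉ K → ξ.1 y = 0) :
    (T.1 ξ).1 x = fsum K fun y => ξ.1 y * (T.1 (L2.single y 1)).1 x := by
  classical
  revert ξ
  suffices h : ∀ ξ : L2 R X, (∀ y, y ∉ K → ξ.1 y = 0) →
      (T.1 ξ).1 x = fsum K fun y => ξ.1 y * (T.1 (L2.single y 1)).1 x from fun {ξ} => h ξ
  refine FinPow.induction (P := fun K => ∀ ξ : L2 R X, (∀ y, y ∉ K → ξ.1 y = 0) →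
    (T.1 ξ).1 x = fsum K fun y => ξ.1 y * (T.1 (L2.single y 1)).1 x) ?_ ?_ ?_ K
  · simp only [forall_iff_not_exists_not, imp_iff_not_or]
    fun_prop
  · intro ξ hξ
    rw [fsum_empty (by fun_prop)]
    exact T.apply_eq_zero (fun y => hξ y (FinPow.not_mem_empty y)) x
  · intro z K hz ih ξ hξ
    -- Subtracting `ξ(z) e_z` leaves a vector supported in `K`, to which the induction hypothesis
    -- applies.
    have hη : ∀ y, (L2.lin 1 ξ (- ξ.1 z) (L2.single z 1)).1 y = if y = z then 0 else ξ.1 y := by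
      intro y
      rw [L2.lin_apply, L2.single_apply]
      split_ifs with h
      · rw [h]
        ring
      · ring
    have h1 := ih (L2.lin 1 ξ (- ξ.1 z) (L2.single z 1)) fun y hy => by
      rw [hη]
      split_ifs with h
      · rfl
      · exact hξ y fun hyK => (FinPow.mem_insert.1 hyK).elim h hy
    have h2 : fsum K (fun y => (L2.lin 1 ξ (- ξ.1 z) (L2.single z 1)).1 y *
        (T.1 (L2.single y 1)).1 x) = fsum K fun y => ξ.1 y * (T.1 (L2.single y 1)).1 x := by
      refine fsum_congr (by fun_prop) (by fun_prop) fun y hy => ?_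
      rw [hη, if_neg]
      rintro rfl
      exact hz hy
    rw [fsum_insert (by fun_prop) hz, ← h2, ← h1, T.lin_apply]
    ring

theorem Op.ext_single {S T : Op R X}
    (h : ∀ y x, (S.1 (L2.single y 1)).1 x = (T.1 (L2.single y 1)).1 x) : S = T := by
  refine Op.ext fun ξ x => ?_
  rw [S.apply_eq_fsum x fun y hy => L2.apply_eq_zero hy,
    T.apply_eq_fsum x fun y hy => L2.apply_eq_zero hy]
  simp only [h]

theorem IsAdjoint.apply_single {T U : Op R X} (h : IsAdjoint T U) (x y : El X) :
    (U.1 (L2.single x 1)).1 y = star ((T.1 (L2.single y 1)).1 x) := by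
  rw [← ip_single, ip_conj, ← isAdjoint_iff.1 h, ip_single]

theorem isFin_omega (n : Omega M) : IsFin n.1 :=
  ⟨n, (internal_id (M := M) (α := El n.1)).toIFun, by
    have : ⇑(internal_id (M := M) (α := El n.1)).toIFun = id := funext fun x =>
      Internal.toIFun_apply _ x
    rw [this]
    exact Function.bijective_id⟩

/-- A natural number as a finite subset of itself. -/
def omegaTop (n : Omega M) : FinPow n.1 := ⟨⟨n.1, fun _ h => h⟩, isFin_omega n⟩

theorem mem_omegaTop {n : Omega M} (i : El n.1) : i ∈ omegaTop n := i.2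

theorem isMatProd_iff {n : Omega M} {a b c : MatOp R X n} : IsMatProd a b c ↔
    ∀ (i j : El n.1) (ξ : L2 R X) (x : El X), ((c (i, j)).1 ξ).1 x =
      fsum (omegaTop n) fun k => ((a (i, k)).1 ((b (k, j)).1 ξ)).1 x := by
  refine forall_congr' fun i => forall_congr' fun j => forall_congr' fun ξ =>
    forall_congr' fun x => ?_
  exact hasSumOver_iff (F := omegaTop n)
    (f := fun k => ((a (i, k)).1 ((b (k, j)).1 ξ)).1 x) (by fun_prop)

/-- Each matrix entry of `v v*` is compared with that of `1` inside a finite set `K` containing its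
two indices and invariant under the entries of `v` and of `w = v*`. On `n × K` the matrix of `v` is
isometric, hence unitary. -/
theorem isStablyFinite : IsStablyFinite R X := by
  classical
  rintro n ⟨v, w, p, q, hvw, hp, hq, hp1, hqp⟩
  rw [isMatProd_iff] at hp hq
  refine hqp (IFun.ext fun ⟨i, j⟩ => Op.ext_single fun y x => ?_)
  -- A point `y` is related to the points in the supports of all `v_ij e_y` and `w_ij e_y`. There
  -- are finitely many of these supports and each is finite, so the relation is locally finite.
  have hE : Internal M (fun r : El X × El X => ∃ i j : El n.1,
      ¬ ((v (i, j)).1 (L2.single r.1 1)).1 r.2 = 0 ∨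
      ¬ ((w (i, j)).1 (L2.single r.1 1)).1 r.2 = 0) := by fun_prop
  obtain ⟨K, hxy, hK⟩ := FinPow.exists_closed_rel hX.out (E := fun y x => ∃ i j : El n.1,
      ¬ ((v (i, j)).1 (L2.single y 1)).1 x = 0 ∨
      ¬ ((w (i, j)).1 (L2.single y 1)).1 x = 0) hE (fun y => by
    have h1 : ∀ i, ∃ G : FinPow X, ∀ x, (∃ j : El n.1,
        ¬ ((v (i, j)).1 (L2.single y 1)).1 x = 0 ∨
        ¬ ((w (i, j)).1 (L2.single y 1)).1 x = 0) → x ∈ G := fun i => by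
      obtain ⟨G, hG⟩ := (omegaTop n).exists_biUnion (E := fun j x =>
          ¬ ((v (i, j)).1 (L2.single y 1)).1 x = 0 ∨
          ¬ ((w (i, j)).1 (L2.single y 1)).1 x = 0) (by fun_prop) fun j _ =>
        ⟨((v (i, j)).1 (L2.single y 1)).supp ∪ ((w (i, j)).1 (L2.single y 1)).supp, fun x hx =>
          FinPow.mem_union.2 (hx.imp L2.mem_supp.2 L2.mem_supp.2)⟩
      exact ⟨G, fun x ⟨j, hj⟩ => hG j (mem_omegaTop j) x hj⟩
    obtain ⟨G, hG⟩ := (omegaTop n).exists_biUnion (E := fun i x => ∃ j : El n.1,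
        ¬ ((v (i, j)).1 (L2.single y 1)).1 x = 0 ∨
        ¬ ((w (i, j)).1 (L2.single y 1)).1 x = 0) (by fun_prop) fun i _ => h1 i
    exact ⟨G, fun x ⟨i, hi⟩ => hG i (mem_omegaTop i) x hi⟩) (insert x (insert y ∅))
  have hxK : x ∈ K := hxy x (FinPow.mem_insert.2 (Or.inl rfl))
  have hyK : y ∈ K := hxy y (FinPow.mem_insert.2 (Or.inr (FinPow.mem_insert.2 (Or.inl rfl))))
  have hv0 : ∀ i j y, y ∈ K → ∀ x, x ∉ K → ((v (i, j)).1 (L2.single y 1)).1 x = 0 := by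
    intro i j y hy x hx
    by_contra h
    exact hx (hK y hy x ⟨i, j, Or.inl h⟩)
  have hw0 : ∀ i j y, y ∈ K → ∀ x, x ∉ K → ((w (i, j)).1 (L2.single y 1)).1 x = 0 := by
    intro i j y hy x hx
    by_contra h
    exact hx (hK y hy x ⟨i, j, Or.inr h⟩)
  have hwv : ∀ i j y x, ((w (i, j)).1 (L2.single y 1)).1 x =
      star (((v (j, i)).1 (L2.single x 1)).1 y) := fun i j y x => (hvw j i).apply_single y x
  have hpv : ∀ i j y x, ((p (i, j)).1 (L2.single y 1)).1 x = if (i, x) = (j, y) then 1 else 0 := by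
    intro i j y x
    by_cases hij : i = j
    · rw [(hp1 i j).1 hij, L2.single_apply]
      simp [hij]
    · rw [(hp1 i j).2 hij, if_neg fun h => hij (Prod.ext_iff.1 h).1]
  have hVi : Internal M (fun r : (El n.1 × El X) × (El n.1 × El X) =>
    ((v (r.1.1, r.2.1)).1 (L2.single r.2.2 1)).1 r.1.2) := by fun_prop
  obtain ⟨V, hV⟩ : ∃ V : IFun M ((El n.1 × El X) × (El n.1 × El X)) (Cplx R), ∀ k z j y,
      V ((k, z), (j, y)) = ((v (k, j)).1 (L2.single y 1)).1 z :=
    ⟨hVi.toIFun, fun k z j y => hVi.toIFun_apply ((k, z), (j, y))⟩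
  -- Since `v` maps `e_y'` with `y' ∈ K` to a vector supported in `K`, the entries of `w v = 1` are
  -- sums over `n × K`; this is the isometry hypothesis.
  have hiso := dsum_mul_star_of_isometry (F := omegaTop n) (K := K) (V := V) (by
    rintro ⟨j, y⟩ ⟨j', y'⟩ - hy - hy'
    rw [← hpv, hp, dsum]
    dsimp only at hy hy' ⊢
    congr 1
    funext k
    rw [(w (j, k)).apply_eq_fsum y (hv0 k j' y' hy')]
    congr 1
    funext z
    rw [hV, hV, hwv]
    ring) (i, x) (j, y) (mem_omegaTop i) hxK (mem_omegaTop j) hyK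
  -- For `v w` it is the invariance of `K` under the entries of `w` that reduces the sum to `n × K`.
  rw [hpv, hq, ← hiso, dsum]
  congr 1
  funext k
  rw [(v (i, k)).apply_eq_fsum x (hw0 k j y hyK)]
  congr 1
  funext z
  rw [hV, hV, hwv]
  ring

end Finiteness

end ZFModel

theorem propositionP {M : Type u} [Membership M M] [ZFModel.ModelsZF M]
    (R : M) [Field (ZFModel.El R)] [LinearOrder (ZFModel.El R)] (hR : ZFModel.IsReals R)
    (X : M) (hX : ZFModel.IsCF X)
    (hμ : ¬ ∃ μ : ZFModel.IFun M (ZFModel.Pow X) (ZFModel.El R),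
      ZFModel.IsFinAddProb μ ∧ ZFModel.VanishesOnSingletons μ) :
    ZFModel.IsStablyFinite R X ∧
    (¬ ∃ τ : ZFModel.IFun M (ZFModel.Op R X) (ZFModel.Cplx R), ZFModel.IsTracialState τ) ∧
    (∀ S T : ZFModel.Op R X, S ≠ T →
      ∃ φ : ZFModel.IFun M (ZFModel.Op R X) (ZFModel.Cplx R), ZFModel.IsState φ ∧ φ S ≠ φ T) := by
  have := Fact.mk hR
  have := Fact.mk hX.2
  exact ⟨ZFModel.isStablyFinite, fun ⟨_, hτ⟩ => hμ (hτ.exists_isFinAddProb hX.1),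
    fun _ _ h => ZFModel.exists_isState_ne h⟩
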